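/- Let $M$ be a quaternionic contact manifold: a smooth manifold with a smooth rank $h$ distribution $H\subseteq TM$ satisfying $[H,H]=TM$ and a smooth inner product on $H$, such that, with $V^*\subseteq T^*M$ the annihilator of $H$ and $\mathcal J:V^*\to \mathrm{End}(H)$ given by $\langle \mathcal J(\xi)X,Y\rangle=d\xi(X,Y)$, at every point $V^*$ has a basis $\xi^1,\xi^2,\xi^3$ with $\mathcal J(\xi^a)^2=-1=\mathcal J(\xi^1)\mathcal J(\xi^2)\mathcal J(\xi^3)$. Use the inner product $\langle A,B\rangle=\mathrm{tr}(B^{\top}A)$ and its norm on $\mathrm{End}(H)$, and $\langle\xi,\eta\rangle=\frac1h\langle\mathcal J(\xi),\mathcal J(\eta)\rangle$ on $V^*$. Let $V$ be a complement of $H$ in $TM$, let $g$ be the Riemannian metric that extends the inner product of $H$, makes $H\perp V$, and is dual to the inner product of $V^*$ on $V$, and let $\nabla$ be a connection on $TM$, with torsion $\mathrm{Tor}$, such that $(V,\nabla)$ has the defining properties of the Biquard connection: $H$, $V$, $g$ and $\mathcal J$ are parallel; $\mathrm{Tor}(H,H)\subseteq V$ and $\mathrm{Tor}(H,V)\subseteq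 H$; and for each $U\in V$ the skew-symmetric part of $\mathrm{Tor}(U,\cdot):H\to H$ is orthogonal to $\mathcal J(V^*)$ and to all skew-symmetric operators commuting with $\mathcal J(V^*)$. Assume that the distribution $V$ is integrable. Let $U_1,U_2,U_3$ be a local orthonormal frame of $V$ with dual coframe $\eta^1,\eta^2,\eta^3$ and $J_a=\mathcal J(\eta^a)$, oriented so that $J_1J_2J_3=-1$. Let $T^{\Sigma}_a$ and $T^{\mathfrak o}_a$ be the symmetric and skew-symmetric parts of $\mathrm{Tor}(U_a,\cdot):H\to H$, and for $A\in\mathrm{End}(H)$ let $A^{b^+}=\frac12(A-J_bAJ_b)$ be its component commuting with $J_b$. Then $\|T^{\mathfrak o}_1\|=\|T^{\mathfrak o}_2\|=\|T^{\mathfrak o}_3\|=:\overline{\mathcal T}$, and for $a\neq b$ the sectional curvature $K(U_a,U_b)=\langle R(U_a,U_b)U_b,U_a\rangle$ of $\nabla$ satisfies $$\frac h4\,K(U_a,U_b)=\overline{\mathcal T}^2-\big\|(T^{\Sigma}_a)^{b^+}\big\|^2=\overline{\mathcal T}^2-\big\|(T^{\Sigma}_b)^{a^+}\big\|^2 .$$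 -/

import Mathlib

open Bundle VectorField
open scoped Manifold ContDiff Topology

noncomputable section

namespace QC

/-! ### Linear algebra on the operators of a Euclidean space -/

section Operators

variable {W : Type*} [NormedAddCommGroup W] [InnerProductSpace ℝ W] [FiniteDimensional ℝ W]

/-- The inner product `⟨A, B⟩ = tr (Bᵀ A)` on `End W`. -/
def opInner (A B : W →ₗ[ℝ] W) : ℝ :=
  LinearMap.trace ℝ W (LinearMap.adjoint B ∘ₗ A)

/-- The norm of the inner product `opInner`. -/
def opNorm (A : W →ₗ[ℝ] W) : ℝ := Real.sqrt (opInner A A)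

/-- The symmetric part of an operator. -/
def symPart (A : W →ₗ[ℝ] W) : W →ₗ[ℝ] W := (1 / 2 : ℝ) • (A + LinearMap.adjoint A)

/-- The skew-symmetric part of an operator. -/
def skewPart (A : W →ₗ[ℝ] W) : W →ₗ[ℝ] W := (1 / 2 : ℝ) • (A - LinearMap.adjoint A)

/-- For `J ∘ J = -1`: the component of `A` that commutes with `J` in the decomposition of `End W`
into operators commuting and anti-commuting with `J`. -/
def commPart (J A : W →ₗ[ℝ] W) : W →ₗ[ℝ] W := (1 / 2 : ℝ) • (A - J ∘ₗ A ∘ₗ J)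

end Operators

/-! ### Distributions on a manifold -/

section Manifold

variable {E : Type*} [NormedAddCommGroup E] [NormedSpace ℝ E] [FiniteDimensional ℝ E]
  {M : Type*} [TopologicalSpace M] [ChartedSpace E M] [IsManifold 𝓘(ℝ, E) ∞ M]

instance finiteDimensionalTangentSpace (x : M) :
    FiniteDimensional ℝ (TangentSpace 𝓘(ℝ, E) x) :=
  inferInstanceAs (FiniteDimensional ℝ E)

/-- `X` is smooth at `x` and takes values in the distribution `D` near `x`. -/
def IsSectionAt (D : (x : M) → Submodule ℝ (TangentSpace 𝓘(ℝ, E) x))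
    (X : (x : M) → TangentSpace 𝓘(ℝ, E) x) (x : M) : Prop :=
  CMDiffAt ∞ (T% X) x ∧ ∀ᶠ y in 𝓝 x, X y ∈ D y

/-- `D` is a smooth distribution of rank `h`: it has smooth local frames of `h` vector fields. -/
def IsSmoothDistribution (h : ℕ) (D : (x : M) → Submodule ℝ (TangentSpace 𝓘(ℝ, E) x)) : Prop :=
  ∀ x : M, ∃ (O : Set M) (F : Fin h → (y : M) → TangentSpace 𝓘(ℝ, E) y),
    IsOpen O ∧ x ∈ O ∧ (∀ i, CMDiff[O] ∞ (T% (F i))) ∧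
    ∀ y ∈ O, LinearIndependent ℝ (fun i => F i y) ∧
      Submodule.span ℝ (Set.range fun i => F i y) = D y

/-- `D` is closed under Lie brackets (integrability in the sense of Frobenius). -/
def IsInvolutive (D : (x : M) → Submodule ℝ (TangentSpace 𝓘(ℝ, E) x)) : Prop :=
  ∀ (x : M) (X Y : (y : M) → TangentSpace 𝓘(ℝ, E) y),
    IsSectionAt D X x → IsSectionAt D Y x → mlieBracket 𝓘(ℝ, E) X Y x ∈ D x

/-- `[D, D] = TM` at every point. -/
def IsStepTwo (D : (x : M) → Submodule ℝ (TangentSpace 𝓘(ℝ, E) x)) : Prop :=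
  ∀ x : M, Submodule.span ℝ {v : TangentSpace 𝓘(ℝ, E) x |
    ∃ X Y : (y : M) → TangentSpace 𝓘(ℝ, E) y,
      IsSectionAt D X x ∧ IsSectionAt D Y x ∧ v = mlieBracket 𝓘(ℝ, E) X Y x} = ⊤

/-! ### Quaternionic contact structures

A sub-Riemannian metric on `H` together with a complement `V` is encoded by its canonical
extension, a Riemannian metric on `M` for which `V` is the orthogonal complement of `H`: the
metric on `H` is the restriction, and the metric on `V` is normalized in
`IsQuaternionicContact.canonical`. Every triple (`H`, metric on `H`, complement `V`) comes from
exactly one such Riemannian metric. -/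

variable [RiemannianBundle (fun x : M => TangentSpace 𝓘(ℝ, E) x)]
  [IsContMDiffRiemannianBundle 𝓘(ℝ, E) ∞ E (fun x : M => TangentSpace 𝓘(ℝ, E) x)]


/-- The tangent vector `v` projected orthogonally to `H x`. -/
def horProj (H : (x : M) → Submodule ℝ (TangentSpace 𝓘(ℝ, E) x)) (x : M) :
    TangentSpace 𝓘(ℝ, E) x →ₗ[ℝ] H x :=
  ((H x).orthogonalProjectionOnto : TangentSpace 𝓘(ℝ, E) x →L[ℝ] H x)

/-- The vertical distribution `V`. -/
def vert (H : (x : M) → Submodule ℝ (TangentSpace 𝓘(ℝ, E) x)) (x : M) :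
    Submodule ℝ (TangentSpace 𝓘(ℝ, E) x) := (H x)ᗮ

/-- The covectors at `x` that annihilate `H`, i.e. the fibre of `V*`. -/
def annih (H : (x : M) → Submodule ℝ (TangentSpace 𝓘(ℝ, E) x)) (x : M) :
    Submodule ℝ (TangentSpace 𝓘(ℝ, E) x →L[ℝ] ℝ) where
  carrier := {ξ | ∀ v ∈ H x, ξ v = 0}
  add_mem' := fun ha hb v hv => by simp [ha v hv, hb v hv]
  zero_mem' := fun v _ => by simp
  smul_mem' := fun c ξ hξ v hv => by simp [hξ v hv]

/-- `A` is the operator on `H x` with `⟨A X, Y⟩ = dξ(X, Y)` for horizontal `X`, `Y`. If `ξ` is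
extended to a 1-form that annihilates `H`, then
`dξ(X, Y) = X (ξ Y) - Y (ξ X) - ξ [X, Y] = - ξ [X, Y]`. -/
def IsJ (H : (x : M) → Submodule ℝ (TangentSpace 𝓘(ℝ, E) x)) (x : M)
    (ξ : TangentSpace 𝓘(ℝ, E) x →L[ℝ] ℝ) (A : H x →ₗ[ℝ] H x) : Prop :=
  ∀ X Y : (y : M) → TangentSpace 𝓘(ℝ, E) y, IsSectionAt H X x → IsSectionAt H Y x →
    inner ℝ (A (horProj H x (X x))) (horProj H x (Y x)) = - ξ (mlieBracket 𝓘(ℝ, E) X Y x)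

/-- The bundle map `𝒥 : V* → End H`: the operator determined by `IsJ`. -/
def J (H : (x : M) → Submodule ℝ (TangentSpace 𝓘(ℝ, E) x)) (x : M)
    (ξ : TangentSpace 𝓘(ℝ, E) x →L[ℝ] ℝ) : H x →ₗ[ℝ] H x :=
  Classical.epsilon (IsJ H x ξ)

/-- `𝒥` as a map on `V`, through the metric identification `U ↦ ⟨U, ·⟩` of `V` with `V*`. -/
def JV (H : (x : M) → Submodule ℝ (TangentSpace 𝓘(ℝ, E) x)) (x : M)
    (u : TangentSpace 𝓘(ℝ, E) x) : H x →ₗ[ℝ] H x :=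
  J H x (innerSL ℝ u)

/-- `H` is a quaternionic contact distribution of rank `h`, and the Riemannian metric of `M` is the
canonical extension of its restriction to `H` with respect to the complement `V = Hᗮ`. -/
structure IsQuaternionicContact (h : ℕ) (H : (x : M) → Submodule ℝ (TangentSpace 𝓘(ℝ, E) x)) :
    Prop where
  smooth : IsSmoothDistribution h H
  stepTwo : IsStepTwo H
  /-- At every point `𝒥(V*)` is a copy of `𝔰𝔭₁`, spanned by a quaternionic triple. -/
  quaternionic : ∀ x : M, ∃ (ξ : Fin 3 → (TangentSpace 𝓘(ℝ, E) x →L[ℝ] ℝ))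
    (A : Fin 3 → (H x →ₗ[ℝ] H x)),
    LinearIndependent ℝ ξ ∧ Submodule.span ℝ (Set.range ξ) = annih H x ∧
    (∀ a, IsJ H x (ξ a) (A a)) ∧ (∀ a, A a ∘ₗ A a = -LinearMap.id) ∧
    A 0 ∘ₗ A 1 ∘ₗ A 2 = -LinearMap.id
  /-- On `V*`, the metric is `⟨ξ, ξ⟩ = (1/h) ⟨𝒥(ξ), 𝒥(ξ)⟩`. -/
  canonical : ∀ (x : M), ∀ ξ ∈ annih H x, ‖ξ‖ ^ 2 = (1 / (h : ℝ)) * opInner (J H x ξ) (J H x ξ)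

/-! ### The Biquard connection -/

/-- The operator `X ↦ Tor(u, X)` on `H x`. -/
def torOp (H : (x : M) → Submodule ℝ (TangentSpace 𝓘(ℝ, E) x))
    (cov : CovariantDerivative 𝓘(ℝ, E) E (TangentSpace 𝓘(ℝ, E) : M → Type _)) (x : M)
    (u : TangentSpace 𝓘(ℝ, E) x) : H x →ₗ[ℝ] H x :=
  horProj H x ∘ₗ (cov.torsion x u : TangentSpace 𝓘(ℝ, E) x →ₗ[ℝ] TangentSpace 𝓘(ℝ, E) x) ∘ₗ
    (H x).subtype

/-- The skew-symmetric operators on `H x` that commute with `𝒥(V*)`. -/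
def IsTZero (H : (x : M) → Submodule ℝ (TangentSpace 𝓘(ℝ, E) x)) (x : M)
    (B : H x →ₗ[ℝ] H x) : Prop :=
  LinearMap.adjoint B = -B ∧ ∀ ξ ∈ annih H x, B ∘ₗ J H x ξ = J H x ξ ∘ₗ B

/-- `A` lies in `𝔱^⊥ ⊕ Σ`, where `Σ` are the symmetric operators and `𝔱^⊥` is the orthogonal
complement of `𝔱 = 𝔱₀ ⊕ 𝒥(V*)` in the skew-symmetric ones: the skew-symmetric part of `A` is
orthogonal to `𝔱₀` and to `𝒥(V*)`. -/
def IsTPerpSym (H : (x : M) → Submodule ℝ (TangentSpace 𝓘(ℝ, E) x)) (x : M)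
    (A : H x →ₗ[ℝ] H x) : Prop :=
  (∀ B, IsTZero H x B → opInner (skewPart A) B = 0) ∧
    ∀ ξ ∈ annih H x, opInner (skewPart A) (J H x ξ) = 0

/-- `cov` is a smooth connection on `TM` which, with the complement `V = Hᗮ`, has the defining
properties of the Biquard connection. -/
structure IsBiquardConnection (H : (x : M) → Submodule ℝ (TangentSpace 𝓘(ℝ, E) x))
    (cov : CovariantDerivative 𝓘(ℝ, E) E (TangentSpace 𝓘(ℝ, E) : M → Type _)) : Prop where
  smooth : cov.ContMDiffCovariantDerivative ∞
  parallel_H : ∀ (x : M) (X : (y : M) → TangentSpace 𝓘(ℝ, E) y) (v : TangentSpace 𝓘(ℝ, E) x),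
    IsSectionAt H X x → cov X x v ∈ H x
  parallel_V : ∀ (x : M) (U : (y : M) → TangentSpace 𝓘(ℝ, E) y) (v : TangentSpace 𝓘(ℝ, E) x),
    IsSectionAt (vert H) U x → cov U x v ∈ vert H x
  parallel_metric : ∀ (x : M) (X Y : (y : M) → TangentSpace 𝓘(ℝ, E) y)
    (v : TangentSpace 𝓘(ℝ, E) x), CMDiffAt ∞ (T% X) x → CMDiffAt ∞ (T% Y) x →
    mvfderiv 𝓘(ℝ, E) (fun y => inner ℝ (X y) (Y y)) x v =
      inner ℝ (cov X x v) (Y x) + inner ℝ (X x) (cov Y x v)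
  /-- `∇_v (𝒥(U) X) = 𝒥(∇_v U) X + 𝒥(U) ∇_v X` -/
  parallel_J : ∀ (x : M) (U X : (y : M) → TangentSpace 𝓘(ℝ, E) y)
    (v : TangentSpace 𝓘(ℝ, E) x), IsSectionAt (vert H) U x → IsSectionAt H X x →
    cov (fun y => (JV H y (U y) (horProj H y (X y)) : TangentSpace 𝓘(ℝ, E) y)) x v =
      (JV H x (cov U x v) (horProj H x (X x)) : TangentSpace 𝓘(ℝ, E) x) +
        (JV H x (U x) (horProj H x (cov X x v)) : TangentSpace 𝓘(ℝ, E) x)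
  torsion_HH : ∀ (x : M), ∀ v ∈ H x, ∀ w ∈ H x, cov.torsion x v w ∈ vert H x
  torsion_HV : ∀ (x : M), ∀ v ∈ H x, ∀ u ∈ vert H x, cov.torsion x v u ∈ H x
  torsion_op : ∀ (x : M), ∀ u ∈ vert H x, IsTPerpSym H x (torOp H cov x u)

/-- `R(X, Y) Z = ∇_X ∇_Y Z - ∇_Y ∇_X Z - ∇_[X,Y] Z` -/
def curvature (cov : CovariantDerivative 𝓘(ℝ, E) E (TangentSpace 𝓘(ℝ, E) : M → Type _))
    (X Y Z : (y : M) → TangentSpace 𝓘(ℝ, E) y) (x : M) : TangentSpace 𝓘(ℝ, E) x :=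
  cov (fun y => cov Z y (Y y)) x (X x) - cov (fun y => cov Z y (X y)) x (Y x) -
    cov Z x (mlieBracket 𝓘(ℝ, E) X Y x)

/-- The sectional curvature `K(X, Y) = ⟨R(X, Y) Y, X⟩ / (|X|² |Y|² - ⟨X, Y⟩²)`. -/
def sectionalCurvature
    (cov : CovariantDerivative 𝓘(ℝ, E) E (TangentSpace 𝓘(ℝ, E) : M → Type _))
    (X Y : (y : M) → TangentSpace 𝓘(ℝ, E) y) (x : M) : ℝ :=
  inner ℝ (curvature cov X Y Y x) (X x) /
    (‖X x‖ ^ 2 * ‖Y x‖ ^ 2 - (inner ℝ (X x) (Y x)) ^ 2)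

/-- `U 0, U 1, U 2` is a smooth oriented orthonormal frame of `V` over the open set `O`. -/
structure IsOrientedVerticalFrame (H : (x : M) → Submodule ℝ (TangentSpace 𝓘(ℝ, E) x))
    (O : Set M) (U : Fin 3 → (y : M) → TangentSpace 𝓘(ℝ, E) y) : Prop where
  isOpen : IsOpen O
  smooth : ∀ a, CMDiff[O] ∞ (T% (U a))
  orthonormal : ∀ y ∈ O, Orthonormal ℝ (fun a => U a y)
  span_eq : ∀ y ∈ O, Submodule.span ℝ (Set.range fun a => U a y) = vert H y
  oriented : ∀ y ∈ O, JV H y (U 0 y) ∘ₗ JV H y (U 1 y) ∘ₗ JV H y (U 2 y) = -LinearMap.id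

/-- `T_a^Σ`, the symmetric part of `T_a = Tor(U_a, ·)` on `H`. -/
def torSym (H : (x : M) → Submodule ℝ (TangentSpace 𝓘(ℝ, E) x))
    (cov : CovariantDerivative 𝓘(ℝ, E) E (TangentSpace 𝓘(ℝ, E) : M → Type _))
    (U : Fin 3 → (y : M) → TangentSpace 𝓘(ℝ, E) y) (a : Fin 3) (x : M) : H x →ₗ[ℝ] H x :=
  symPart (torOp H cov x (U a x))

/-- `T_a^𝔬`, the skew-symmetric part of `T_a = Tor(U_a, ·)` on `H`. -/
def torSkew (H : (x : M) → Submodule ℝ (TangentSpace 𝓘(ℝ, E) x))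
    (cov : CovariantDerivative 𝓘(ℝ, E) E (TangentSpace 𝓘(ℝ, E) : M → Type _))
    (U : Fin 3 → (y : M) → TangentSpace 𝓘(ℝ, E) y) (a : Fin 3) (x : M) : H x →ₗ[ℝ] H x :=
  skewPart (torOp H cov x (U a x))

end Manifold

end QC

end

/-! Write `T_a = Tor(U_a, ·) = S_a + A_a` on `H`, with `S_a` symmetric and `A_a` skew. The theorem
combines two consequences of the first Bianchi identity with quaternionic linear algebra.

Shape of the torsion. For a vertical field `U` of constant length, pair the Bianchi identity of `X,
Y ∈ H` and `U` with `U`. The curvature terms vanish, and what is left (`bianchi_HHV`,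
`exists_torOp_eq`) is `Tᵀ J + J T = 𝒥(w)`, where `T = Tor(U, ·)`, `J = 𝒥(U)` and `w ∈ V` is
orthogonal to `U`. Splitting this into parts commuting and anticommuting with `J`, and using that
the skew part of `T` is orthogonal to `𝒥(V*)`, one finds that the symmetric part anticommutes with
`J` and the skew part commutes with it (`sym_anticomm_skew_comm`). Orthogonality to the skew
operators commuting with `𝒥(V*)` then makes `A_a` anticommute with `J_b` for `b ≠ a`
(`skew_torOp_anticomm`). Applied to `U_a + U_b` as well, the first result polarizes to `A_b = J_a
J_b A_a` and `S_b^{a+} = J_a J_b S_a^{b+}`. Since `J_a J_b` is an isometry, the norms agree, and a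
trace computation (`torsion_pair`) gives `⟨[T_a, T_b], J_a J_b⟩ = 2‖A_a‖² - 2‖S_a^{b+}‖²`.

Curvature. As `V` is integrable, `Tor(V, V) ⊆ V`, and the horizontal part of the Bianchi identity on
two vertical fields and a horizontal one expresses `R(U_a, U_b)` on `H` by derivatives of `T_a,
T_b`, by `Tor([U_a, U_b], ·)` and by `-[T_a, T_b]` (`bianchi_VVH`). Tracing against `𝒥(C)` with `C`
vertical leaves only the commutator, because orthogonality of the torsion operators to `𝒥(V*)` is
preserved by `∇` (`sum_inner_curvature`). Parallelism of `𝒥` gives `𝒥(R(U_a, U_b) U_b) = [R(U_a,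
U_b), J_b]`, hence `h K(U_a, U_b) = 2⟨[T_a, T_b], J_a J_b⟩` (`inner_curvature_eq`). -/

set_option linter.unusedSectionVars false

noncomputable section

namespace QC

/-! ### Smooth fields, covariant derivatives and the first Bianchi identity -/

section Calculus

variable {E : Type*} [NormedAddCommGroup E] [NormedSpace ℝ E] [FiniteDimensional ℝ E]
  {M : Type*} [TopologicalSpace M] [ChartedSpace E M] [IsManifold 𝓘(ℝ, E) ∞ M]

/-- The vector field `X` is smooth at every point of `N`. -/
def SmoothField (N : Set M) (X : (y : M) → TangentSpace 𝓘(ℝ, E) y) : Prop :=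
  ∀ y ∈ N, CMDiffAt ∞ (T% X) y

/-- The vector field `∇_X Y`. -/
def nabla (cov : CovariantDerivative 𝓘(ℝ, E) E (TangentSpace 𝓘(ℝ, E) : M → Type _))
    (X Y : (y : M) → TangentSpace 𝓘(ℝ, E) y) (y : M) : TangentSpace 𝓘(ℝ, E) y :=
  cov Y y (X y)

/-- The vector field `Tor(X, Y)`. -/
def torField (cov : CovariantDerivative 𝓘(ℝ, E) E (TangentSpace 𝓘(ℝ, E) : M → Type _))
    (X Y : (y : M) → TangentSpace 𝓘(ℝ, E) y) (y : M) : TangentSpace 𝓘(ℝ, E) y :=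
  cov.torsion y (X y) (Y y)

variable {N : Set M} {X Y Z : (y : M) → TangentSpace 𝓘(ℝ, E) y}
  {cov : CovariantDerivative 𝓘(ℝ, E) E (TangentSpace 𝓘(ℝ, E) : M → Type _)}

theorem SmoothField.mdifferentiableAt (hX : SmoothField N X) {y : M} (hy : y ∈ N) :
    MDiffAt (T% X) y :=
  (hX y hy).mdifferentiableAt (by simp)

theorem SmoothField.mono {N' : Set M} (hX : SmoothField N X) (h : N' ⊆ N) : SmoothField N' X :=
  fun y hy => hX y (h hy)

theorem SmoothField.add (hX : SmoothField N X) (hY : SmoothField N Y) : SmoothField N (X + Y) :=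
  fun y hy => (hX y hy).add_section (hY y hy)

theorem SmoothField.sub (hX : SmoothField N X) (hY : SmoothField N Y) : SmoothField N (X - Y) :=
  fun y hy => (hX y hy).sub_section (hY y hy)

theorem SmoothField.smul {f : M → ℝ} (hf : ∀ y ∈ N, CMDiffAt ∞ f y) (hX : SmoothField N X) :
    SmoothField N (f • X) :=
  fun y hy => (hf y hy).smul_section (hX y hy)

theorem SmoothField.const_smul (c : ℝ) (hX : SmoothField N X) : SmoothField N (c • X) :=
  fun y hy => (hX y hy).const_smul_section

theorem SmoothField.sum {ι : Type*} {s : Finset ι} {F : ι → (y : M) → TangentSpace 𝓘(ℝ, E) y}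
    (hF : ∀ i ∈ s, SmoothField N (F i)) : SmoothField N (fun y => ∑ i ∈ s, F i y) :=
  fun y hy => ContMDiffAt.sum_section fun i hi => hF i hi y hy

theorem SmoothField.congr (hN : IsOpen N) (hX : SmoothField N X) (h : ∀ y ∈ N, Y y = X y) :
    SmoothField N Y := fun y hy => by
  refine (hX y hy).congr_of_eventuallyEq ?_
  filter_upwards [hN.mem_nhds hy] with z hz
  simp [h z hz]

theorem SmoothField.bracket (hX : SmoothField N X) (hY : SmoothField N Y) :
    SmoothField N (mlieBracket 𝓘(ℝ, E) X Y) := fun y hy => by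
  have : IsManifold 𝓘(ℝ, E) ((⊤ : ℕ∞) + 1) M := by
    simpa using (inferInstance : IsManifold 𝓘(ℝ, E) ∞ M)
  have : IsManifold 𝓘(ℝ, E) (minSmoothness ℝ 2) M := by
    refine IsManifold.of_le (n := ∞) ?_
    simpa using (WithTop.coe_le_coe.2 le_top : ((2 : ℕ∞) : WithTop ℕ∞) ≤ ((⊤ : ℕ∞) : WithTop ℕ∞))
  exact ContMDiffAt.mlieBracket_vectorField (m := ⊤) (n := ⊤) (hX y hy) (hY y hy) (by simp)

/-- Smoothness of the connection is applied to globally smooth sections. A bump function equal to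
one near the point extends the local field, and locality of `∇` removes it again. -/
theorem SmoothField.nabla [T2Space M] (hcov : cov.ContMDiffCovariantDerivative ∞) (hN : IsOpen N)
    (hX : SmoothField N X) (hY : SmoothField N Y) : SmoothField N (nabla cov X Y) := by
  intro y hy
  obtain ⟨f, hf⟩ : ∃ f : SmoothBumpFunction 𝓘(ℝ, E) y, tsupport f ⊆ N := by
    obtain ⟨f, -, hf⟩ := (SmoothBumpFunction.nhds_basis_tsupport (I := 𝓘(ℝ, E)) y).mem_iff.1
      (hN.mem_nhds hy)
    exact ⟨f, hf⟩
  have hfY : CMDiff ∞ (T% ((f : M → ℝ) • Y)) :=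
    ContMDiffOn.smul_section_of_tsupport (u := N) f.contMDiff.contMDiffOn hN hf
      fun z hz => (hY z hz).contMDiffWithinAt
  have h1 := hcov.contMDiff.contMDiff (σ := (f : M → ℝ) • Y)
    (by simpa using! hfY.contMDiffOn) y trivial
  rw [contMDiffWithinAt_univ] at h1
  have h2 := ContMDiffAt.clm_bundle_apply h1 (hX y hy)
  refine h2.congr_of_eventuallyEq ?_
  filter_upwards [hN.mem_nhds hy, f.eventuallyEq_one.eventually_nhds] with z hz hfz
  simp only [QC.nabla]
  congr 2
  refine cov.isCovariantDerivativeOn (s := Set.univ) |>.congr_of_eventuallyEq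
    (hY.mdifferentiableAt hz) ((hfY z).mdifferentiableAt (by simp)) Filter.univ_mem ?_
  filter_upwards [hfz] with w hw
  simp [hw]

theorem cov_congr (hN : IsOpen N) (hX : SmoothField N X) (h : ∀ y ∈ N, Y y = X y) {y : M}
    (hy : y ∈ N) : cov Y y = cov X y :=
  cov.isCovariantDerivativeOn.congr_of_eqOn ((hX.congr hN h).mdifferentiableAt hy)
    (hX.mdifferentiableAt hy) (hN.mem_nhds hy) h

theorem cov_add (hX : SmoothField N X) (hY : SmoothField N Y) {y : M} (hy : y ∈ N) :
    cov (X + Y) y = cov X y + cov Y y :=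
  cov.isCovariantDerivativeOn.add (hX.mdifferentiableAt hy) (hY.mdifferentiableAt hy)
    (Set.mem_univ y)

theorem cov_const_smul (c : ℝ) (hX : SmoothField N X) {y : M} (hy : y ∈ N) :
    cov (c • X) y = c • cov X y :=
  cov.isCovariantDerivativeOn.smul_const c (hX.mdifferentiableAt hy) (Set.mem_univ y)

theorem cov_sub (hX : SmoothField N X) (hY : SmoothField N Y) {y : M} (hy : y ∈ N) :
    cov (X - Y) y = cov X y - cov Y y := by
  have h : X - Y = X + (-1 : ℝ) • Y := by
    funext z
    simp [sub_eq_add_neg]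
  rw [h, cov_add hX (hY.const_smul _) hy, cov_const_smul _ hY hy]
  simp [sub_eq_add_neg]

theorem torField_eq (hX : SmoothField N X) (hY : SmoothField N Y) {y : M} (hy : y ∈ N) :
    torField cov X Y y = (nabla cov X Y - nabla cov Y X - mlieBracket 𝓘(ℝ, E) X Y) y :=
  cov.torsion_apply (hX.mdifferentiableAt hy) (hY.mdifferentiableAt hy)

theorem SmoothField.torField [T2Space M] (hcov : cov.ContMDiffCovariantDerivative ∞)
    (hN : IsOpen N) (hX : SmoothField N X) (hY : SmoothField N Y) :
    SmoothField N (torField cov X Y) :=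
  (((hX.nabla hcov hN hY).sub (hY.nabla hcov hN hX)).sub (hX.bracket hY)).congr hN
    fun _ hy => torField_eq hX hY hy

theorem cov_torField [T2Space M] (hcov : cov.ContMDiffCovariantDerivative ∞)
    (hN : IsOpen N) (hX : SmoothField N X) (hY : SmoothField N Y) {y : M} (hy : y ∈ N) :
    cov (torField cov X Y) y =
      cov (nabla cov X Y) y - cov (nabla cov Y X) y - cov (mlieBracket 𝓘(ℝ, E) X Y) y := by
  have h1 := hX.nabla hcov hN hY
  have h2 := hY.nabla hcov hN hX
  rw [cov_congr hN ((h1.sub h2).sub (hX.bracket hY)) (fun _ hz => torField_eq hX hY hz) hy,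
    cov_sub (h1.sub h2) (hX.bracket hY) hy, cov_sub h1 h2 hy]

theorem jacobi (hX : SmoothField N X) (hY : SmoothField N Y) (hZ : SmoothField N Z)
    {y : M} (hy : y ∈ N) :
    mlieBracket 𝓘(ℝ, E) X (mlieBracket 𝓘(ℝ, E) Y Z) y +
      mlieBracket 𝓘(ℝ, E) Y (mlieBracket 𝓘(ℝ, E) Z X) y +
      mlieBracket 𝓘(ℝ, E) Z (mlieBracket 𝓘(ℝ, E) X Y) y = 0 := by
  have hle : minSmoothness ℝ 2 ≤ (∞ : WithTop ℕ∞) := by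
    simpa using (WithTop.coe_le_coe.2 le_top : ((2 : ℕ∞) : WithTop ℕ∞) ≤ ((⊤ : ℕ∞) : WithTop ℕ∞))
  have : IsManifold 𝓘(ℝ, E) (minSmoothness ℝ 3) M := by
    refine IsManifold.of_le (n := ∞) ?_
    simpa using (WithTop.coe_le_coe.2 le_top : ((3 : ℕ∞) : WithTop ℕ∞) ≤ ((⊤ : ℕ∞) : WithTop ℕ∞))
  rw [leibniz_identity_mlieBracket_apply (I := 𝓘(ℝ, E)) ((hX y hy).of_le hle)
    ((hY y hy).of_le hle) ((hZ y hy).of_le hle),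
    mlieBracket_swap_apply (V := mlieBracket 𝓘(ℝ, E) X Y) (W := Z),
    mlieBracket_swap (V := Z) (W := X)]
  have h : mlieBracket 𝓘(ℝ, E) Y (-mlieBracket 𝓘(ℝ, E) X Z) y =
      -mlieBracket 𝓘(ℝ, E) Y (mlieBracket 𝓘(ℝ, E) X Z) y := by
    have := mlieBracket_const_smul_right (I := 𝓘(ℝ, E)) (V := Y) (c := (-1 : ℝ))
      ((hX.bracket hZ).mdifferentiableAt hy)
    simpa using this
  rw [h]
  abel

/-- The first Bianchi identity for a connection with torsion. -/
theorem bianchi [T2Space M] (hcov : cov.ContMDiffCovariantDerivative ∞)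
    (hN : IsOpen N) (hX : SmoothField N X) (hY : SmoothField N Y) (hZ : SmoothField N Z)
    {y : M} (hy : y ∈ N) :
    curvature cov X Y Z y + curvature cov Y Z X y + curvature cov Z X Y y =
      cov (torField cov Y Z) y (X y) + cov (torField cov Z X) y (Y y) +
        cov (torField cov X Y) y (Z y) +
      (cov.torsion y (X y) (mlieBracket 𝓘(ℝ, E) Y Z y) +
        cov.torsion y (Y y) (mlieBracket 𝓘(ℝ, E) Z X y) +
        cov.torsion y (Z y) (mlieBracket 𝓘(ℝ, E) X Y y)) := by
  rw [cov_torField hcov hN hX hY hy, cov_torField hcov hN hY hZ hy, cov_torField hcov hN hZ hX hy,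
    cov.torsion_apply (hX.mdifferentiableAt hy) ((hY.bracket hZ).mdifferentiableAt hy),
    cov.torsion_apply (hY.mdifferentiableAt hy) ((hZ.bracket hX).mdifferentiableAt hy),
    cov.torsion_apply (hZ.mdifferentiableAt hy) ((hX.bracket hY).mdifferentiableAt hy)]
  -- With every torsion expanded, the terms `∇_X [Y, Z]` cancel in pairs and the double brackets sum
  -- to zero by the Jacobi identity.
  have hj := jacobi hX hY hZ hy
  rw [add_assoc, ← eq_neg_iff_add_eq_zero] at hj
  simp only [curvature, hj, sub_apply]
  change cov (nabla cov Y Z) y (X y) - cov (nabla cov X Z) y (Y y) - _ +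
    (cov (nabla cov Z X) y (Y y) - cov (nabla cov Y X) y (Z y) - _) +
    (cov (nabla cov X Y) y (Z y) - cov (nabla cov Z Y) y (X y) - _) = _
  abel

end Calculus

/-! ### Operators whose squares are scalar -/

section OperatorLemmas

variable {W : Type*} [NormedAddCommGroup W] [InnerProductSpace ℝ W] [FiniteDimensional ℝ W]

theorem adjoint_mul (A B : Module.End ℝ W) :
    LinearMap.adjoint (A * B) = LinearMap.adjoint B * LinearMap.adjoint A :=
  LinearMap.adjoint_comp A B

theorem adjoint_eq_neg_iff {A : W →ₗ[ℝ] W} :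
    LinearMap.adjoint A = -A ↔ ∀ v w, inner ℝ (A v) w = -inner ℝ v (A w) := by
  rw [eq_comm, LinearMap.eq_adjoint_iff]
  simp only [LinearMap.neg_apply, inner_neg_left]
  exact forall₂_congr fun v w => neg_eq_iff_eq_neg

theorem opInner_eq_trace (A B : Module.End ℝ W) :
    opInner A B = LinearMap.trace ℝ W (LinearMap.adjoint B * A) := rfl

theorem opInner_eq_sum {ι : Type*} [Fintype ι] (b : OrthonormalBasis ι ℝ W) (A B : W →ₗ[ℝ] W) :
    opInner A B = ∑ i, inner ℝ (A (b i)) (B (b i)) := by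
  rw [opInner, LinearMap.trace_eq_sum_inner _ b]
  refine Finset.sum_congr rfl fun i _ => ?_
  rw [LinearMap.comp_apply, LinearMap.adjoint_inner_right, real_inner_comm]

theorem opInner_self_eq_zero {A : W →ₗ[ℝ] W} : opInner A A = 0 ↔ A = 0 := by
  constructor
  · intro h
    rw [opInner_eq_sum (stdOrthonormalBasis ℝ W),
      Finset.sum_eq_zero_iff_of_nonneg fun i _ => real_inner_self_nonneg] at h
    refine (stdOrthonormalBasis ℝ W).toBasis.ext fun i => ?_
    simpa using h i (Finset.mem_univ i)
  · rintro rfl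
    simp [opInner]

theorem opInner_self_of_sq {A : W →ₗ[ℝ] W} {r : ℝ} (hA : LinearMap.adjoint A = -A)
    (hr : A ∘ₗ A = -r • LinearMap.id) : opInner A A = r * Module.finrank ℝ W := by
  rw [opInner, hA, LinearMap.neg_comp, hr, neg_smul, neg_neg, map_smul, LinearMap.trace_id,
    smul_eq_mul]

/-- Polarization: a linear space of operators with scalar squares has scalar anticommutators. -/
theorem anticomm_of_sq {A B : W →ₗ[ℝ] W} {r s t : ℝ} (hA : A ∘ₗ A = -r • LinearMap.id)
    (hB : B ∘ₗ B = -s • LinearMap.id) (hAB : (A + B) ∘ₗ (A + B) = -(r + t + s) • LinearMap.id) :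
    A ∘ₗ B + B ∘ₗ A = -t • LinearMap.id := by
  rw [LinearMap.add_comp, LinearMap.comp_add, LinearMap.comp_add, hA, hB] at hAB
  rw [← sub_eq_zero] at hAB ⊢
  rw [← hAB]
  module

/-- Combinations of the three generators of a quaternionic structure square to a scalar. -/
theorem quaternionic_sq {A : Fin 3 → Module.End ℝ W} (hskew : ∀ a, LinearMap.adjoint (A a) = -A a)
    (hsq : ∀ a, A a * A a = -1) (hprod : A 0 * (A 1 * A 2) = -1) (c : Fin 3 → ℝ) :
    (∑ a, c a • A a) * (∑ a, c a • A a) = -(∑ a, c a ^ 2) • (1 : Module.End ℝ W) := by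
  have h01 : A 0 * A 1 = A 2 := by
    have h := congrArg (· * A 2) hprod
    simp only [mul_assoc, hsq] at h
    simpa using h
  have h12 : A 1 * A 2 = A 0 := by
    have h := congrArg (A 0 * ·) hprod
    simp only [← mul_assoc, hsq] at h
    simpa using h
  have h10 : A 1 * A 0 = -A 2 := by
    have h := congrArg LinearMap.adjoint h01
    simpa [adjoint_mul, hskew] using h
  have h21 : A 2 * A 1 = -A 0 := by
    have h := congrArg LinearMap.adjoint h12
    simpa [adjoint_mul, hskew] using h
  have h02 : A 0 * A 2 = -A 1 := by
    rw [← h01, ← mul_assoc, hsq]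
    simp
  have h20 : A 2 * A 0 = A 1 := by
    have h := congrArg LinearMap.adjoint h02
    simpa [adjoint_mul, hskew] using h
  simp only [Fin.sum_univ_three, mul_add, add_mul, smul_mul_assoc, mul_smul_comm, hsq, h01, h12,
    h10, h21, h02, h20]
  module

end OperatorLemmas

/-! ### The map `𝒥` at a point -/

section Pointwise

variable {E : Type*} [NormedAddCommGroup E] [NormedSpace ℝ E] [FiniteDimensional ℝ E]
  {M : Type*} [TopologicalSpace M] [ChartedSpace E M] [IsManifold 𝓘(ℝ, E) ∞ M]
  [RiemannianBundle (fun x : M => TangentSpace 𝓘(ℝ, E) x)]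
  [IsContMDiffRiemannianBundle 𝓘(ℝ, E) ∞ E (fun x : M => TangentSpace 𝓘(ℝ, E) x)]
  {h : ℕ} {H : (x : M) → Submodule ℝ (TangentSpace 𝓘(ℝ, E) x)} {x : M}

theorem horProj_of_mem {v : TangentSpace 𝓘(ℝ, E) x} (hv : v ∈ H x) : horProj H x v = ⟨v, hv⟩ :=
  (H x).orthogonalProjectionOnto_mem_subspace_eq_self ⟨v, hv⟩

theorem horProj_coe (v : H x) : horProj H x (v : TangentSpace 𝓘(ℝ, E) x) = v :=
  horProj_of_mem v.2

theorem inner_horProj_right (u : H x) (v : TangentSpace 𝓘(ℝ, E) x) :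
    inner ℝ u (horProj H x v) = inner ℝ (u : TangentSpace 𝓘(ℝ, E) x) v :=
  (H x).inner_orthogonalProjectionOnto_eq_of_mem_left u v

theorem inner_horProj_left (u : H x) (v : TangentSpace 𝓘(ℝ, E) x) :
    inner ℝ (horProj H x v) u = inner ℝ v (u : TangentSpace 𝓘(ℝ, E) x) :=
  (H x).inner_orthogonalProjectionOnto_eq_of_mem_right u v

theorem IsSmoothDistribution.exists_section (hH : IsSmoothDistribution h H)
    {v : TangentSpace 𝓘(ℝ, E) x} (hv : v ∈ H x) :
    ∃ (N : Set M) (X : (y : M) → TangentSpace 𝓘(ℝ, E) y), IsOpen N ∧ x ∈ N ∧ SmoothField N X ∧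
      (∀ y ∈ N, X y ∈ H y) ∧ X x = v := by
  obtain ⟨N, F, hN, hx, hF, hspan⟩ := hH x
  rw [← (hspan x hx).2, Submodule.mem_span_range_iff_exists_fun] at hv
  obtain ⟨c, hc⟩ := hv
  refine ⟨N, fun y => ∑ i, (c i • F i) y, hN, hx, SmoothField.sum fun i _ =>
    SmoothField.const_smul _ fun y hy => (hF i y hy).contMDiffAt (hN.mem_nhds hy), fun y hy => ?_,
    by simpa using hc⟩
  refine Submodule.sum_mem _ fun i _ => Submodule.smul_mem _ _ ?_
  rw [← (hspan y hy).2]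
  exact Submodule.subset_span ⟨i, rfl⟩

theorem SmoothField.isSectionAt {N : Set M} {X : (y : M) → TangentSpace 𝓘(ℝ, E) y}
    {D : (x : M) → Submodule ℝ (TangentSpace 𝓘(ℝ, E) x)} (hX : SmoothField N X) (hN : IsOpen N)
    (hD : ∀ y ∈ N, X y ∈ D y) {y : M} (hy : y ∈ N) : IsSectionAt D X y :=
  ⟨hX y hy, Filter.mem_of_superset (hN.mem_nhds hy) hD⟩

theorem IsSmoothDistribution.exists_isSectionAt (hH : IsSmoothDistribution h H)
    (v : H x) : ∃ X, IsSectionAt H X x ∧ horProj H x (X x) = v := by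
  obtain ⟨N, X, hN, hx, hX, hXH, hXv⟩ := hH.exists_section v.2
  exact ⟨X, hX.isSectionAt hN hXH hx, by rw [hXv, horProj_coe]⟩

theorem IsSmoothDistribution.finrank_eq (hH : IsSmoothDistribution h H) (x : M) :
    Module.finrank ℝ (H x) = h := by
  obtain ⟨N, F, hN, hx, hF, hspan⟩ := hH x
  rw [← (hspan x hx).2, finrank_span_eq_card (hspan x hx).1, Fintype.card_fin]

/-- Every horizontal vector is the value of a horizontal section, so the bracket formula fixes all
matrix entries of the operator. -/
theorem IsJ.unique (hH : IsSmoothDistribution h H) {ξ : TangentSpace 𝓘(ℝ, E) x →L[ℝ] ℝ}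
    {A B : H x →ₗ[ℝ] H x} (hA : IsJ H x ξ A) (hB : IsJ H x ξ B) : A = B := by
  refine LinearMap.ext fun v => ext_inner_right ℝ fun w => ?_
  obtain ⟨X, hX, rfl⟩ := hH.exists_isSectionAt v
  obtain ⟨Y, hY, rfl⟩ := hH.exists_isSectionAt w
  rw [hA X Y hX hY, hB X Y hX hY]

theorem IsJ.adjoint (hH : IsSmoothDistribution h H) {ξ : TangentSpace 𝓘(ℝ, E) x →L[ℝ] ℝ}
    {A : H x →ₗ[ℝ] H x} (hA : IsJ H x ξ A) : LinearMap.adjoint A = -A := by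
  refine adjoint_eq_neg_iff.2 fun v w => ?_
  obtain ⟨X, hX, rfl⟩ := hH.exists_isSectionAt v
  obtain ⟨Y, hY, rfl⟩ := hH.exists_isSectionAt w
  rw [real_inner_comm (A _) (horProj H x (X x)), hA X Y hX hY, hA Y X hY hX,
    mlieBracket_swap_apply, map_neg]

theorem IsJ.add {ξ η : TangentSpace 𝓘(ℝ, E) x →L[ℝ] ℝ} {A B : H x →ₗ[ℝ] H x} (hA : IsJ H x ξ A)
    (hB : IsJ H x η B) : IsJ H x (ξ + η) (A + B) := fun X Y hX hY => by
  rw [LinearMap.add_apply, inner_add_left, hA X Y hX hY, hB X Y hX hY, add_apply, neg_add]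

theorem IsJ.smul (c : ℝ) {ξ : TangentSpace 𝓘(ℝ, E) x →L[ℝ] ℝ} {A : H x →ₗ[ℝ] H x}
    (hA : IsJ H x ξ A) : IsJ H x (c • ξ) (c • A) := fun X Y hX hY => by
  rw [LinearMap.smul_apply, real_inner_smul_left, hA X Y hX hY]
  simp

theorem IsJ.zero : IsJ H x 0 0 := fun X Y hX hY => by simp

theorem IsJ.sum {ι : Type*} (s : Finset ι) {ξ : ι → TangentSpace 𝓘(ℝ, E) x →L[ℝ] ℝ}
    {A : ι → H x →ₗ[ℝ] H x} (hA : ∀ i, IsJ H x (ξ i) (A i)) :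
    IsJ H x (∑ i ∈ s, ξ i) (∑ i ∈ s, A i) := by
  classical
  induction s using Finset.induction_on with
  | empty => simpa using IsJ.zero
  | insert i s hi ih =>
    rw [Finset.sum_insert hi, Finset.sum_insert hi]
    exact (hA i).add ih

/-- `J` is a choice, so it satisfies its formula only once some operator does. Here that operator is
built by linearity from the quaternionic triple. -/
theorem IsQuaternionicContact.exists_isJ (hqc : IsQuaternionicContact h H)
    {ξ : TangentSpace 𝓘(ℝ, E) x →L[ℝ] ℝ} (hξ : ξ ∈ annih H x) :
    ∃ (A : H x →ₗ[ℝ] H x) (r : ℝ), IsJ H x ξ A ∧ A ∘ₗ A = -r • LinearMap.id := by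
  obtain ⟨η, A, -, hspan, hJ, hsq, hprod⟩ := hqc.quaternionic x
  rw [← hspan, Submodule.mem_span_range_iff_exists_fun] at hξ
  obtain ⟨c, rfl⟩ := hξ
  exact ⟨∑ a, c a • A a, ∑ a, c a ^ 2, IsJ.sum _ fun a => (hJ a).smul _,
    quaternionic_sq (fun a => (hJ a).adjoint hqc.smooth) hsq hprod c⟩

theorem IsQuaternionicContact.isJ_J (hqc : IsQuaternionicContact h H)
    {ξ : TangentSpace 𝓘(ℝ, E) x →L[ℝ] ℝ} (hξ : ξ ∈ annih H x) : IsJ H x ξ (J H x ξ) := by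
  obtain ⟨A, _, hA, -⟩ := hqc.exists_isJ hξ
  exact Classical.epsilon_spec ⟨A, hA⟩

/-- If `𝒥(ξ)² = -r`, then `⟨𝒥(ξ), 𝒥(ξ)⟩ = r h`, and the normalization of the metric on `V*`
identifies `r` with `‖ξ‖²`. -/
theorem IsQuaternionicContact.J_sq (hqc : IsQuaternionicContact h H)
    {ξ : TangentSpace 𝓘(ℝ, E) x →L[ℝ] ℝ} (hξ : ξ ∈ annih H x) :
    J H x ξ ∘ₗ J H x ξ = -‖ξ‖ ^ 2 • LinearMap.id := by
  obtain ⟨A, r, hA, hr⟩ := hqc.exists_isJ hξ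
  have hAJ := hA.unique hqc.smooth (hqc.isJ_J hξ)
  subst hAJ
  have hadj := hA.adjoint hqc.smooth
  have hn := hqc.canonical x ξ hξ
  have hdim := hqc.smooth.finrank_eq x
  have hin : opInner (J H x ξ) (J H x ξ) = r * h := by
    rw [opInner_self_of_sq hadj hr, hdim]
  -- The normalization divides by `h`; for `h = 0` all operators on `H x` coincide.
  rcases Nat.eq_zero_or_pos h with h0 | h0
  · rw [h0, Module.finrank_zero_iff] at hdim
    exact Subsingleton.elim _ _
  · rw [hr, hn, hin]
    congr 2
    field_simp

theorem innerSL_mem_annih {u : TangentSpace 𝓘(ℝ, E) x} (hu : u ∈ vert H x) :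
    innerSL ℝ u ∈ annih H x := fun v hv => by
  rw [innerSL_apply_apply]
  exact (H x).inner_left_of_mem_orthogonal hv hu

theorem mem_annih_iff {ξ : TangentSpace 𝓘(ℝ, E) x →L[ℝ] ℝ} :
    ξ ∈ annih H x ↔ ∃ u ∈ vert H x, ξ = innerSL ℝ u := by
  constructor
  · intro hξ
    have : CompleteSpace (TangentSpace 𝓘(ℝ, E) x) := FiniteDimensional.complete ℝ _
    refine ⟨(InnerProductSpace.toDual ℝ _).symm ξ, ?_, ?_⟩
    · rw [vert, Submodule.mem_orthogonal']
      intro v hv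
      rw [InnerProductSpace.toDual_symm_apply]
      exact hξ v hv
    · ext v
      rw [innerSL_apply_apply, InnerProductSpace.toDual_symm_apply]
  · rintro ⟨u, hu, rfl⟩
    exact innerSL_mem_annih hu

variable {u w : TangentSpace 𝓘(ℝ, E) x}

theorem IsQuaternionicContact.JV_add (hqc : IsQuaternionicContact h H) (hu : u ∈ vert H x)
    (hw : w ∈ vert H x) : JV H x (u + w) = JV H x u + JV H x w := by
  refine IsJ.unique hqc.smooth (hqc.isJ_J (innerSL_mem_annih (add_mem hu hw))) ?_
  rw [map_add]
  exact (hqc.isJ_J (innerSL_mem_annih hu)).add (hqc.isJ_J (innerSL_mem_annih hw))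

theorem IsQuaternionicContact.JV_smul (hqc : IsQuaternionicContact h H) (c : ℝ)
    (hu : u ∈ vert H x) : JV H x (c • u) = c • JV H x u := by
  refine IsJ.unique hqc.smooth (hqc.isJ_J (innerSL_mem_annih (Submodule.smul_mem _ c hu))) ?_
  rw [map_smul]
  exact (hqc.isJ_J (innerSL_mem_annih hu)).smul c

theorem IsQuaternionicContact.JV_adjoint (hqc : IsQuaternionicContact h H) (hu : u ∈ vert H x) :
    LinearMap.adjoint (JV H x u) = -JV H x u :=
  (hqc.isJ_J (innerSL_mem_annih hu)).adjoint hqc.smooth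

theorem IsQuaternionicContact.JV_sq (hqc : IsQuaternionicContact h H) (hu : u ∈ vert H x) :
    JV H x u ∘ₗ JV H x u = -‖u‖ ^ 2 • LinearMap.id := by
  rw [JV, hqc.J_sq (innerSL_mem_annih hu), innerSL_apply_norm]

theorem IsQuaternionicContact.JV_anticomm (hqc : IsQuaternionicContact h H) (hu : u ∈ vert H x)
    (hw : w ∈ vert H x) :
    JV H x u ∘ₗ JV H x w + JV H x w ∘ₗ JV H x u = -(2 * inner ℝ u w : ℝ) • LinearMap.id := by
  have h1 := hqc.JV_sq (add_mem hu hw)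
  rw [hqc.JV_add hu hw, norm_add_sq_real] at h1
  exact anticomm_of_sq (hqc.JV_sq hu) (hqc.JV_sq hw) h1

theorem IsQuaternionicContact.inner_JV (hqc : IsQuaternionicContact h H) (hu : u ∈ vert H x)
    {X Y : (y : M) → TangentSpace 𝓘(ℝ, E) y} (hX : IsSectionAt H X x) (hY : IsSectionAt H Y x) :
    inner ℝ (JV H x u (horProj H x (X x))) (horProj H x (Y x)) =
      -inner ℝ u (mlieBracket 𝓘(ℝ, E) X Y x) := by
  rw [JV, hqc.isJ_J (innerSL_mem_annih hu) X Y hX hY, innerSL_apply_apply]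

end Pointwise

/-! ### Orthonormal frames of `H` -/

section Frames

variable {E : Type*} [NormedAddCommGroup E] [NormedSpace ℝ E] [FiniteDimensional ℝ E]
  {M : Type*} [TopologicalSpace M] [ChartedSpace E M] [IsManifold 𝓘(ℝ, E) ∞ M]
  [RiemannianBundle (fun x : M => TangentSpace 𝓘(ℝ, E) x)]
  [IsContMDiffRiemannianBundle 𝓘(ℝ, E) ∞ E (fun x : M => TangentSpace 𝓘(ℝ, E) x)]
  {h : ℕ} {H : (x : M) → Submodule ℝ (TangentSpace 𝓘(ℝ, E) x)}

theorem SmoothField.inner {N : Set M} {X Y : (y : M) → TangentSpace 𝓘(ℝ, E) y}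
    (hX : SmoothField N X) (hY : SmoothField N Y) :
    ∀ y ∈ N, CMDiffAt ∞ (fun y => inner ℝ (X y) (Y y)) y :=
  fun y hy => ContMDiffAt.inner_bundle (IB := 𝓘(ℝ, E)) (F := E)
    (E := fun x : M => TangentSpace 𝓘(ℝ, E) x) (b := fun y => y) (hX y hy) (hY y hy)

/-- `e` is a smooth orthonormal frame of `H` over the open set `N`. -/
structure IsHorizontalFrame (H : (x : M) → Submodule ℝ (TangentSpace 𝓘(ℝ, E) x)) (N : Set M)
    (e : Fin h → (y : M) → TangentSpace 𝓘(ℝ, E) y) : Prop where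
  isOpen : IsOpen N
  smooth : ∀ i, SmoothField N (e i)
  orthonormal : ∀ y ∈ N, Orthonormal ℝ (fun i => e i y)
  span_eq : ∀ y ∈ N, Submodule.span ℝ (Set.range fun i => e i y) = H y

theorem smoothField_gramSchmidt {N : Set M} (hN : IsOpen N)
    {F : Fin h → (y : M) → TangentSpace 𝓘(ℝ, E) y} (hF : ∀ i, SmoothField N (F i))
    (hind : ∀ y ∈ N, LinearIndependent ℝ (fun i => F i y)) (i : Fin h) :
    SmoothField N (fun y => InnerProductSpace.gramSchmidt ℝ (fun j => F j y) i) := by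
  induction i using WellFoundedLT.induction with
  | ind i ih =>
    set G : Fin h → (y : M) → TangentSpace 𝓘(ℝ, E) y :=
      fun j y => InnerProductSpace.gramSchmidt ℝ (fun j => F j y) j
    have hsum : SmoothField N (fun y => ∑ j ∈ Finset.Iio i,
        ((fun y => inner ℝ (G j y) (F i y) / inner ℝ (G j y) (G j y)) • G j) y) := by
      refine SmoothField.sum fun j hj => ?_
      have hGj := ih j (Finset.mem_Iio.1 hj)
      refine SmoothField.smul (fun y hy => ?_) hGj
      refine (hGj.inner (hF i) y hy).div₀ (hGj.inner hGj y hy) ?_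
      exact inner_self_ne_zero.2 (InnerProductSpace.gramSchmidt_ne_zero j (hind y hy))
    refine ((hF i).sub hsum).congr hN fun y hy => ?_
    have hdef := InnerProductSpace.gramSchmidt_def'' ℝ (fun j => F j y) i
    rw [Pi.sub_apply, eq_sub_iff_add_eq]
    conv_rhs => rw [hdef]
    congr 1
    refine Finset.sum_congr rfl fun j _ => ?_
    simp only [Pi.smul_apply', G, real_inner_self_eq_norm_sq]
    rfl

theorem IsSmoothDistribution.exists_frame (hH : IsSmoothDistribution h H) (x : M) :
    ∃ (N : Set M) (e : Fin h → (y : M) → TangentSpace 𝓘(ℝ, E) y),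
      x ∈ N ∧ IsHorizontalFrame H N e := by
  obtain ⟨N, F, hN, hx, hF, hspan⟩ := hH x
  have hF' : ∀ i, SmoothField N (F i) := fun i y hy => (hF i y hy).contMDiffAt (hN.mem_nhds hy)
  have hG := smoothField_gramSchmidt hN hF' fun y hy => (hspan y hy).1
  refine ⟨N, fun i y => InnerProductSpace.gramSchmidtNormed ℝ (fun j => F j y) i, hx, hN,
    fun i => ?_, fun y hy => InnerProductSpace.gramSchmidtNormed_orthonormal (hspan y hy).1,
    fun y hy => ?_⟩
  · refine (SmoothField.smul (f := fun y => (Real.sqrt (inner ℝ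
      (InnerProductSpace.gramSchmidt ℝ (fun j => F j y) i)
      (InnerProductSpace.gramSchmidt ℝ (fun j => F j y) i)))⁻¹) (fun y hy => ?_) (hG i)).congr hN
      fun y hy => ?_
    · have hne := inner_self_ne_zero (𝕜 := ℝ).2
        (InnerProductSpace.gramSchmidt_ne_zero i (hspan y hy).1)
      have hpos := lt_of_le_of_ne real_inner_self_nonneg hne.symm
      have h1 : ContDiffAt ℝ ∞ (fun t : ℝ => (Real.sqrt t)⁻¹) (inner ℝ
          (InnerProductSpace.gramSchmidt ℝ (fun j => F j y) i)
          (InnerProductSpace.gramSchmidt ℝ (fun j => F j y) i)) :=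
        (Real.contDiffAt_sqrt hne).inv (Real.sqrt_pos.2 hpos).ne'
      exact ContMDiffAt.comp (g := fun t : ℝ => (Real.sqrt t)⁻¹) y h1.contMDiffAt
        ((hG i).inner (hG i) y hy)
    · simp only [InnerProductSpace.gramSchmidtNormed, Pi.smul_apply', real_inner_self_eq_norm_sq,
        Real.sqrt_sq (norm_nonneg _)]
      rfl
  · rw [← (hspan y hy).2]
    exact (InnerProductSpace.span_gramSchmidtNormed_range _).trans
      (InnerProductSpace.span_gramSchmidt ℝ _)

namespace IsHorizontalFrame

variable {N : Set M} {e : Fin h → (y : M) → TangentSpace 𝓘(ℝ, E) y} {y : M}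

theorem mem (he : IsHorizontalFrame H N e) (hy : y ∈ N) (i : Fin h) : e i y ∈ H y := by
  rw [← he.span_eq y hy]
  exact Submodule.subset_span ⟨i, rfl⟩

theorem mono (he : IsHorizontalFrame H N e) {N' : Set M} (hN' : IsOpen N') (hsub : N' ⊆ N) :
    IsHorizontalFrame H N' e :=
  ⟨hN', fun i => (he.smooth i).mono hsub, fun y hy => he.orthonormal y (hsub hy),
    fun y hy => he.span_eq y (hsub hy)⟩

/-- The orthonormal basis of `H y` given by an orthonormal frame. -/
def basis (he : IsHorizontalFrame H N e) (hy : y ∈ N) : OrthonormalBasis (Fin h) ℝ (H y) :=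
  OrthonormalBasis.mk (v := fun i => (⟨e i y, he.mem hy i⟩ : H y))
    ((he.orthonormal y hy).codRestrict (H y) fun i => he.mem hy i) (by
      rw [top_le_iff, ← Submodule.map_injective_of_injective (H y).injective_subtype |>.eq_iff,
        Submodule.map_span, Submodule.map_top, Submodule.range_subtype, ← Set.range_comp]
      exact he.span_eq y hy)

theorem basis_apply (he : IsHorizontalFrame H N e) (hy : y ∈ N) (i : Fin h) :
    he.basis hy i = ⟨e i y, he.mem hy i⟩ :=
  congrFun (OrthonormalBasis.coe_mk _ _) i

theorem sum_inner_smul (he : IsHorizontalFrame H N e) (hy : y ∈ N)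
    {v : TangentSpace 𝓘(ℝ, E) y} (hv : v ∈ H y) : ∑ i, inner ℝ v (e i y) • e i y = v := by
  have := congrArg Subtype.val ((he.basis hy).sum_repr' ⟨v, hv⟩)
  simpa [basis_apply, real_inner_comm] using this

theorem opInner_eq (he : IsHorizontalFrame H N e) (hy : y ∈ N) (A B : H y →ₗ[ℝ] H y) :
    opInner A B = ∑ i, inner ℝ (A (horProj H y (e i y)) : TangentSpace 𝓘(ℝ, E) y)
      (B (horProj H y (e i y)) : TangentSpace 𝓘(ℝ, E) y) := by
  rw [opInner_eq_sum (he.basis hy)]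
  refine Finset.sum_congr rfl fun i _ => ?_
  rw [basis_apply, horProj_of_mem (he.mem hy i), Submodule.coe_inner]

end IsHorizontalFrame

end Frames

/-! ### Consequences of the parallelism axioms and the torsion axioms -/

section Connection

variable {E : Type*} [NormedAddCommGroup E] [NormedSpace ℝ E] [FiniteDimensional ℝ E]
  {M : Type*} [TopologicalSpace M] [ChartedSpace E M] [IsManifold 𝓘(ℝ, E) ∞ M]
  [RiemannianBundle (fun x : M => TangentSpace 𝓘(ℝ, E) x)]
  [IsContMDiffRiemannianBundle 𝓘(ℝ, E) ∞ E (fun x : M => TangentSpace 𝓘(ℝ, E) x)]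
  {h : ℕ} {H : (x : M) → Submodule ℝ (TangentSpace 𝓘(ℝ, E) x)}
  {cov : CovariantDerivative 𝓘(ℝ, E) E (TangentSpace 𝓘(ℝ, E) : M → Type _)}
  {N : Set M} {e : Fin h → (y : M) → TangentSpace 𝓘(ℝ, E) y}
  {A B U X Y Z : (y : M) → TangentSpace 𝓘(ℝ, E) y} {x : M}

/-- `X` is a smooth section of the distribution `D` over `N`. -/
structure SmoothSection (N : Set M) (D : (x : M) → Submodule ℝ (TangentSpace 𝓘(ℝ, E) x))
    (X : (y : M) → TangentSpace 𝓘(ℝ, E) y) : Prop where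
  smooth : SmoothField N X
  mem : ∀ y ∈ N, X y ∈ D y

theorem SmoothSection.isSectionAt {D : (x : M) → Submodule ℝ (TangentSpace 𝓘(ℝ, E) x)}
    (hX : SmoothSection N D X) (hN : IsOpen N) (hx : x ∈ N) : IsSectionAt D X x :=
  hX.smooth.isSectionAt hN hX.mem hx

/-- `𝒥(u) v` as a tangent vector, for vertical `u` and horizontal `v`. -/
def jvec (H : (x : M) → Submodule ℝ (TangentSpace 𝓘(ℝ, E) x)) (x : M)
    (u v : TangentSpace 𝓘(ℝ, E) x) : TangentSpace 𝓘(ℝ, E) x :=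
  (JV H x u (horProj H x v) : TangentSpace 𝓘(ℝ, E) x)

/-- The vector field `𝒥(U) X`. -/
def jField (H : (x : M) → Submodule ℝ (TangentSpace 𝓘(ℝ, E) x))
    (U X : (y : M) → TangentSpace 𝓘(ℝ, E) y) (y : M) : TangentSpace 𝓘(ℝ, E) y :=
  jvec H y (U y) (X y)

theorem jvec_mem (u v : TangentSpace 𝓘(ℝ, E) x) : jvec H x u v ∈ H x := Subtype.prop _

theorem jvec_coe (u : TangentSpace 𝓘(ℝ, E) x) (v : H x) : jvec H x u v = JV H x u v := by
  rw [jvec, horProj_coe]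

theorem inner_vert_hor {u v : TangentSpace 𝓘(ℝ, E) x} (hu : u ∈ vert H x) (hv : v ∈ H x) :
    inner ℝ u v = 0 :=
  (H x).inner_left_of_mem_orthogonal hv hu

theorem inner_hor_vert {u v : TangentSpace 𝓘(ℝ, E) x} (hu : u ∈ vert H x) (hv : v ∈ H x) :
    inner ℝ v u = 0 :=
  (H x).inner_right_of_mem_orthogonal hv hu

theorem inner_jvec (u v w : TangentSpace 𝓘(ℝ, E) x) :
    inner ℝ (jvec H x u v) w = inner ℝ (JV H x u (horProj H x v)) (horProj H x w) :=
  (inner_horProj_right _ _).symm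

theorem IsQuaternionicContact.inner_jvec_left (hqc : IsQuaternionicContact h H)
    {u : TangentSpace 𝓘(ℝ, E) x} (hu : u ∈ vert H x) (v w : TangentSpace 𝓘(ℝ, E) x) :
    inner ℝ (jvec H x u v) w = -inner ℝ v (jvec H x u w) := by
  rw [inner_jvec, adjoint_eq_neg_iff.1 (hqc.JV_adjoint hu), real_inner_comm _ v, inner_jvec,
    real_inner_comm (horProj H x v)]

theorem IsQuaternionicContact.jvec_add_left (hqc : IsQuaternionicContact h H)
    {u u' : TangentSpace 𝓘(ℝ, E) x} (hu : u ∈ vert H x) (hu' : u' ∈ vert H x)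
    (v : TangentSpace 𝓘(ℝ, E) x) : jvec H x (u + u') v = jvec H x u v + jvec H x u' v := by
  rw [jvec, hqc.JV_add hu hu']
  rfl

theorem IsQuaternionicContact.jvec_sub_left (hqc : IsQuaternionicContact h H)
    {u u' : TangentSpace 𝓘(ℝ, E) x} (hu : u ∈ vert H x) (hu' : u' ∈ vert H x)
    (v : TangentSpace 𝓘(ℝ, E) x) : jvec H x (u - u') v = jvec H x u v - jvec H x u' v := by
  rw [eq_sub_iff_add_eq, ← hqc.jvec_add_left (sub_mem hu hu') hu', sub_add_cancel]

theorem jvec_sub_right (u v w : TangentSpace 𝓘(ℝ, E) x) :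
    jvec H x u (v - w) = jvec H x u v - jvec H x u w := by
  simp only [jvec, map_sub]
  rfl

/-- The operator `𝒥(U)` is chosen point by point; smoothness comes from the expansion `𝒥(U) X = -∑
⟨U, [X, e_i]⟩ e_i` in a horizontal frame. -/
theorem IsQuaternionicContact.smoothSection_jField (hqc : IsQuaternionicContact h H)
    (he : IsHorizontalFrame H N e) (hU : SmoothSection N (vert H) U) (hX : SmoothSection N H X) :
    SmoothSection N H (jField H U X) := by
  refine ⟨?_, fun y _ => jvec_mem _ _⟩
  have hs : SmoothField N (fun y => ∑ i,
      ((fun y => inner ℝ ((-1 : ℝ) • U y) (mlieBracket 𝓘(ℝ, E) X (e i) y)) • e i) y) :=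
    SmoothField.sum fun i _ => SmoothField.smul
      ((hU.smooth.const_smul (-1)).inner (hX.smooth.bracket (he.smooth i))) (he.smooth i)
  refine hs.congr he.isOpen fun y hy => ?_
  change jvec H y (U y) (X y) = _
  rw [← he.sum_inner_smul hy (jvec_mem (U y) (X y))]
  refine Finset.sum_congr rfl fun i _ => ?_
  have hi : IsSectionAt H (e i) y :=
    (he.smooth i).isSectionAt he.isOpen (fun z hz => he.mem hz i) hy
  rw [inner_jvec, hqc.inner_JV (hU.mem y hy) (hX.isSectionAt he.isOpen hy) hi]
  simp

theorem mvfderiv_eq_zero_of_const {f : M → ℝ} {c : ℝ} (hN : IsOpen N) (hf : ∀ y ∈ N, f y = c)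
    (hx : x ∈ N) : mvfderiv 𝓘(ℝ, E) f x = 0 := by
  have heq : f =ᶠ[𝓝 x] fun _ => c := Filter.mem_of_superset (hN.mem_nhds hx) hf
  rw [← mvfderiv_const (I := 𝓘(ℝ, E)) c (x := x), mvfderiv, mvfderiv, heq.mfderiv_eq, heq.eq_of_nhds]

theorem mvfderiv_congr {f g : M → ℝ} (hN : IsOpen N) (hf : ∀ y ∈ N, f y = g y)
    (hx : x ∈ N) : mvfderiv 𝓘(ℝ, E) f x = mvfderiv 𝓘(ℝ, E) g x := by
  have heq : f =ᶠ[𝓝 x] g := Filter.mem_of_superset (hN.mem_nhds hx) hf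
  rw [mvfderiv, mvfderiv, heq.mfderiv_eq, heq.eq_of_nhds]

namespace IsBiquardConnection

theorem inner_cov_of_const (hcov : IsBiquardConnection H cov) (hN : IsOpen N)
    (hU : SmoothField N U) {c : ℝ}
    (hc : ∀ y ∈ N, inner ℝ (U y) (U y) = c) (hx : x ∈ N) (v : TangentSpace 𝓘(ℝ, E) x) :
    inner ℝ (cov U x v) (U x) = 0 := by
  have h1 := hcov.parallel_metric x U U v (hU x hx) (hU x hx)
  rw [mvfderiv_eq_zero_of_const hN hc hx, real_inner_comm (cov U x v) (U x), zero_apply] at h1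
  linarith

theorem cov_mem_hor (hcov : IsBiquardConnection H cov) (hN : IsOpen N) (hX : SmoothSection N H X)
    (hx : x ∈ N)
    (v : TangentSpace 𝓘(ℝ, E) x) : cov X x v ∈ H x :=
  hcov.parallel_H x X v (hX.isSectionAt hN hx)

theorem cov_mem_vert (hcov : IsBiquardConnection H cov) (hN : IsOpen N) (hX : SmoothSection N
    (vert H) X) (hx : x ∈ N)
    (v : TangentSpace 𝓘(ℝ, E) x) : cov X x v ∈ vert H x :=
  hcov.parallel_V x X v (hX.isSectionAt hN hx)

theorem torsion_VH (hcov : IsBiquardConnection H cov) {u v : TangentSpace 𝓘(ℝ, E) x}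
    (hu : u ∈ vert H x) (hv : v ∈ H x) :
    cov.torsion x u v ∈ H x := by
  rw [cov.torsion_antisymm]
  exact neg_mem (hcov.torsion_HV x v hv u hu)

/-- In `Tor(X, Y) = ∇_X Y - ∇_Y X - [X, Y]` the first two terms are horizontal, and the vertical
part of `-[X, Y]` is what defines `𝒥`. -/
theorem inner_torsion_HH (hcov : IsBiquardConnection H cov)
    (hqc : IsQuaternionicContact h H) {u v w : TangentSpace 𝓘(ℝ, E) x}
    (hu : u ∈ vert H x) (hv : v ∈ H x) (hw : w ∈ H x) :
    inner ℝ (cov.torsion x v w) u = inner ℝ (jvec H x u v) w := by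
  obtain ⟨N, X, hN, hx, hX, hXH, rfl⟩ := hqc.smooth.exists_section hv
  obtain ⟨N', Y, hN', hx', hY, hYH, rfl⟩ := hqc.smooth.exists_section hw
  have hXs := hX.isSectionAt hN hXH hx
  have hYs := hY.isSectionAt hN' hYH hx'
  rw [cov.torsion_apply (hX.mdifferentiableAt hx) (hY.mdifferentiableAt hx'), inner_sub_left,
    inner_sub_left, inner_hor_vert hu (hcov.parallel_H x Y _ hYs),
    inner_hor_vert hu (hcov.parallel_H x X _ hXs), inner_jvec, hqc.inner_JV hu hXs hYs,
    real_inner_comm]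
  simp

variable [T2Space M]

theorem nabla_hor (hcov : IsBiquardConnection H cov) (hN : IsOpen N) (hX : SmoothSection N H X)
    (hA : SmoothField N A) :
    SmoothSection N H (nabla cov A X) :=
  ⟨hA.nabla hcov.smooth hN hX.smooth, fun _ hy => hcov.cov_mem_hor hN hX hy _⟩

theorem nabla_vert (hcov : IsBiquardConnection H cov) (hN : IsOpen N) (hX : SmoothSection N
    (vert H) X) (hA : SmoothField N A) :
    SmoothSection N (vert H) (nabla cov A X) :=
  ⟨hA.nabla hcov.smooth hN hX.smooth, fun _ hy => hcov.cov_mem_vert hN hX hy _⟩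

theorem torField_VH (hcov : IsBiquardConnection H cov) (hN : IsOpen N) (hU : SmoothSection N
    (vert H) U) (hX : SmoothSection N H X) :
    SmoothSection N H (torField cov U X) :=
  ⟨hU.smooth.torField hcov.smooth hN hX.smooth,
    fun y hy => hcov.torsion_VH (hU.mem y hy) (hX.mem y hy)⟩

theorem torField_HV (hcov : IsBiquardConnection H cov) (hN : IsOpen N) (hX : SmoothSection N H X)
    (hU : SmoothSection N (vert H) U) :
    SmoothSection N H (torField cov X U) :=
  ⟨hX.smooth.torField hcov.smooth hN hU.smooth,
    fun y hy => hcov.torsion_HV y _ (hX.mem y hy) _ (hU.mem y hy)⟩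

theorem torsion_VV (hcov : IsBiquardConnection H cov) (hV : IsInvolutive (vert H)) (hN : IsOpen N)
    (hA : SmoothSection N (vert H) A)
    (hB : SmoothSection N (vert H) B) (hx : x ∈ N) :
    cov.torsion x (A x) (B x) ∈ vert H x := by
  rw [cov.torsion_apply (hA.smooth.mdifferentiableAt hx) (hB.smooth.mdifferentiableAt hx)]
  exact sub_mem (sub_mem (hcov.cov_mem_vert hN hB hx _) (hcov.cov_mem_vert hN hA hx _))
    (hV x A B (hA.isSectionAt hN hx) (hB.isSectionAt hN hx))

theorem curvature_hor (hcov : IsBiquardConnection H cov) (hN : IsOpen N)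
    (hX : SmoothSection N H X) (hA : SmoothField N A)
    (hB : SmoothField N B) (hx : x ∈ N) : curvature cov A B X x ∈ H x :=
  sub_mem (sub_mem (hcov.cov_mem_hor hN (hcov.nabla_hor hN hX hB) hx _)
    (hcov.cov_mem_hor hN (hcov.nabla_hor hN hX hA) hx _)) (hcov.cov_mem_hor hN hX hx _)

theorem curvature_vert (hcov : IsBiquardConnection H cov) (hN : IsOpen N) (hX : SmoothSection N
    (vert H) X) (hA : SmoothField N A)
    (hB : SmoothField N B) (hx : x ∈ N) : curvature cov A B X x ∈ vert H x :=
  sub_mem (sub_mem (hcov.cov_mem_vert hN (hcov.nabla_vert hN hX hB) hx _)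
    (hcov.cov_mem_vert hN (hcov.nabla_vert hN hX hA) hx _)) (hcov.cov_mem_vert hN hX hx _)

/-- Differentiating `⟨∇_B U, U⟩ = 0` gives `⟨∇_A ∇_B U, U⟩ = -⟨∇_B U, ∇_A U⟩`, which is symmetric in
`A` and `B`. -/
theorem inner_curvature_self (hcov : IsBiquardConnection H cov) (hN : IsOpen N)
    (hU : SmoothField N U) {c : ℝ}
    (hc : ∀ y ∈ N, inner ℝ (U y) (U y) = c) (hA : SmoothField N A) (hB : SmoothField N B)
    (hx : x ∈ N) : inner ℝ (curvature cov A B U x) (U x) = 0 := by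
  have key : ∀ {A B : (y : M) → TangentSpace 𝓘(ℝ, E) y}, SmoothField N B →
      inner ℝ (cov (nabla cov B U) x (A x)) (U x) = -inner ℝ (cov U x (B x)) (cov U x (A x)) := by
    intro A B hB
    have h1 := hcov.parallel_metric x (nabla cov B U) U (A x)
      (hB.nabla hcov.smooth hN hU x hx) (hU x hx)
    have h2 : mvfderiv 𝓘(ℝ, E) (fun y => inner ℝ (nabla cov B U y) (U y)) x = 0 :=
      mvfderiv_eq_zero_of_const hN (fun y hy => hcov.inner_cov_of_const hN hU hc hy _) hx
    rw [h2, zero_apply] at h1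
    exact eq_neg_of_add_eq_zero_left h1.symm
  have h1 := key (A := A) hB
  have h2 := key (A := B) hA
  change inner ℝ (cov (nabla cov B U) x (A x) - cov (nabla cov A U) x (B x) - _) _ = 0
  rw [inner_sub_left, inner_sub_left, h1, h2, hcov.inner_cov_of_const hN hU hc hx,
    real_inner_comm]
  ring

theorem cov_jField (hcov : IsBiquardConnection H cov) (hN : IsOpen N) (hU : SmoothSection N
    (vert H) U) (hX : SmoothSection N H X)
    (hx : x ∈ N) (v : TangentSpace 𝓘(ℝ, E) x) :
    cov (jField H U X) x v = jvec H x (cov U x v) (X x) + jvec H x (U x) (cov X x v) :=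
  hcov.parallel_J x U X v (hU.isSectionAt hN hx) (hX.isSectionAt hN hx)

/-- Differentiate `⟨Tor(X, Y), U⟩ = ⟨𝒥(U) X, Y⟩`. The two terms with `∇_v U` agree by the same
formula and cancel, which expresses that the horizontal torsion is parallel. -/
theorem inner_cov_torField_HH (hcov : IsBiquardConnection H cov) (hqc : IsQuaternionicContact h H)
    (he : IsHorizontalFrame H N e)
    (hU : SmoothSection N (vert H) U) (hX : SmoothSection N H X) (hY : SmoothSection N H Y)
    (hx : x ∈ N) (v : TangentSpace 𝓘(ℝ, E) x) :
    inner ℝ (cov (torField cov X Y) x v) (U x) =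
      inner ℝ (jvec H x (U x) (cov X x v)) (Y x) + inner ℝ (jvec H x (U x) (X x)) (cov Y x v) := by
  have hN := he.isOpen
  have hJ := hqc.smoothSection_jField he hU hX
  have h1 := hcov.parallel_metric x (torField cov X Y) U v
    (hX.smooth.torField hcov.smooth hN hY.smooth x hx) (hU.smooth x hx)
  have h2 := hcov.parallel_metric x (jField H U X) Y v (hJ.smooth x hx) (hY.smooth x hx)
  have h3 : mvfderiv 𝓘(ℝ, E) (fun y => inner ℝ (torField cov X Y y) (U y)) x =
      mvfderiv 𝓘(ℝ, E) (fun y => inner ℝ (jField H U X y) (Y y)) x :=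
    mvfderiv_congr hN (fun y hy => hcov.inner_torsion_HH hqc (hU.mem y hy) (hX.mem y hy)
      (hY.mem y hy)) hx
  have h4 : inner ℝ (torField cov X Y x) (cov U x v) = inner ℝ (jvec H x (cov U x v) (X x)) (Y x) :=
    hcov.inner_torsion_HH hqc (hcov.cov_mem_vert hN hU hx v) (hX.mem x hx) (hY.mem x hx)
  have h5 : jField H U X x = jvec H x (U x) (X x) := rfl
  rw [h3, h2, hcov.cov_jField hN hU hX hx, inner_add_left, h4, h5] at h1
  linarith

/-- The vertical part of the Bianchi identity on two horizontal and one vertical field. -/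
theorem bianchi_HHV (hcov : IsBiquardConnection H cov) (hqc : IsQuaternionicContact h H)
    (he : IsHorizontalFrame H N e)
    (hU : SmoothSection N (vert H) U) {c : ℝ} (hc : ∀ y ∈ N, inner ℝ (U y) (U y) = c)
    (hX : SmoothSection N H X) (hY : SmoothSection N H Y) (hx : x ∈ N) :
    inner ℝ (jvec H x (U x) (X x)) (cov.torsion x (U x) (Y x)) +
      inner ℝ (jvec H x (U x) (cov.torsion x (U x) (X x))) (Y x) =
    inner ℝ (cov.torsion x (U x) (cov.torsion x (X x) (Y x))) (U x) := by
  have hN := he.isOpen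
  have hUx := hU.mem x hx
  have hXx := hX.mem x hx
  have hYx := hY.mem x hx
  have hb := congrArg (fun v => inner ℝ v (U x))
    (bianchi hcov.smooth hN hX.smooth hY.smooth hU.smooth hx)
  have e1 : mlieBracket 𝓘(ℝ, E) Y U x =
      cov U x (Y x) - cov Y x (U x) - cov.torsion x (Y x) (U x) := by
    rw [cov.torsion_apply (hY.smooth.mdifferentiableAt hx) (hU.smooth.mdifferentiableAt hx)]
    abel
  have e2 : mlieBracket 𝓘(ℝ, E) U X x =
      cov X x (U x) - cov U x (X x) - cov.torsion x (U x) (X x) := by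
    rw [cov.torsion_apply (hU.smooth.mdifferentiableAt hx) (hX.smooth.mdifferentiableAt hx)]
    abel
  have e3 : mlieBracket 𝓘(ℝ, E) X Y x =
      cov Y x (X x) - cov X x (Y x) - cov.torsion x (X x) (Y x) := by
    rw [cov.torsion_apply (hX.smooth.mdifferentiableAt hx) (hY.smooth.mdifferentiableAt hx)]
    abel
  have hUX := hcov.torsion_VH hUx hXx
  have hYU := hcov.torsion_HV x _ hYx _ hUx
  have cU := hcov.cov_mem_vert hN hU hx
  have cX := hcov.cov_mem_hor hN hX hx
  have cY := hcov.cov_mem_hor hN hY hx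
  -- Once the brackets are written through `∇` and `Tor`, the terms containing `∇X` and `∇Y` cancel
  -- and those containing `∇U` are horizontal; only expressions algebraic in the torsion remain.
  simp only [inner_add_left, e1, e2, e3, map_sub, inner_sub_left] at hb
  rw [hcov.inner_curvature_self hN hU.smooth hc hX.smooth hY.smooth hx,
    inner_hor_vert hUx (hcov.curvature_hor hN hX hY.smooth hU.smooth hx),
    inner_hor_vert hUx (hcov.curvature_hor hN hY hU.smooth hX.smooth hx),
    inner_hor_vert hUx (hcov.cov_mem_hor hN (hcov.torField_HV hN hY hU) hx _),
    inner_hor_vert hUx (hcov.cov_mem_hor hN (hcov.torField_VH hN hU hX) hx _),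
    hcov.inner_cov_torField_HH hqc he hU hX hY hx,
    inner_hor_vert hUx (hcov.torsion_HV x _ hXx _ (cU _)),
    hcov.inner_torsion_HH hqc hUx hXx (cY _),
    hcov.inner_torsion_HH hqc hUx hXx hYU,
    inner_hor_vert hUx (hcov.torsion_HV x _ hYx _ (cU _)),
    hcov.inner_torsion_HH hqc hUx hYx (cX _),
    hcov.inner_torsion_HH hqc hUx hYx hUX,
    inner_hor_vert hUx (hcov.torsion_VH hUx (cY _)),
    inner_hor_vert hUx (hcov.torsion_VH hUx (cX _)),
    hqc.inner_jvec_left hUx (Y x), hqc.inner_jvec_left hUx (Y x),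
    real_inner_comm _ (Y x), real_inner_comm _ (Y x), cov.torsion_antisymm (Y x),
    inner_neg_right] at hb
  linarith

/-- The horizontal part of the Bianchi identity on two vertical fields and a horizontal one. -/
theorem bianchi_VVH (hcov : IsBiquardConnection H cov) (hV : IsInvolutive (vert H)) (hN : IsOpen N)
    (hA : SmoothSection N (vert H) A) (hB : SmoothSection N (vert H) B)
    (hZ : SmoothSection N H Z) (hx : x ∈ N) {w : TangentSpace 𝓘(ℝ, E) x} (hw : w ∈ H x) :
    inner ℝ (curvature cov A B Z x) w =
      inner ℝ (cov (torField cov B Z) x (A x) - cov.torsion x (B x) (cov Z x (A x))) w -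
      inner ℝ (cov (torField cov A Z) x (B x) - cov.torsion x (A x) (cov Z x (B x))) w -
      inner ℝ (cov.torsion x (mlieBracket 𝓘(ℝ, E) A B x) (Z x)) w -
      inner ℝ (cov.torsion x (A x) (cov.torsion x (B x) (Z x)) -
        cov.torsion x (B x) (cov.torsion x (A x) (Z x))) w := by
  have hb := congrArg (fun v => inner ℝ v w)
    (bianchi hcov.smooth hN hA.smooth hB.smooth hZ.smooth hx)
  have e1 : mlieBracket 𝓘(ℝ, E) B Z x =
      cov Z x (B x) - cov B x (Z x) - cov.torsion x (B x) (Z x) := by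
    rw [cov.torsion_apply (hB.smooth.mdifferentiableAt hx) (hZ.smooth.mdifferentiableAt hx)]
    abel
  have e2 : mlieBracket 𝓘(ℝ, E) Z A x =
      cov A x (Z x) - cov Z x (A x) + cov.torsion x (A x) (Z x) := by
    rw [mlieBracket_swap_apply,
      cov.torsion_apply (hA.smooth.mdifferentiableAt hx) (hZ.smooth.mdifferentiableAt hx)]
    abel
  have e3 : cov (torField cov Z A) x = -cov (torField cov A Z) x := by
    have hT := (hcov.torField_VH hN hA hZ).smooth
    rw [cov_congr (X := (-1 : ℝ) • torField cov A Z) hN (hT.const_smul (-1)) (fun y hy => ?_) hx,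
      cov_const_smul _ hT hx, neg_one_smul]
    rw [Pi.smul_apply, neg_one_smul]
    exact cov.torsion_antisymm _ _
  -- Integrability of `V` enters here: it makes `Tor(A, B)` vertical, so its derivative has no
  -- horizontal component.
  have hTV : SmoothSection N (vert H) (torField cov A B) :=
    ⟨hA.smooth.torField hcov.smooth hN hB.smooth, fun y hy => hcov.torsion_VV hV hN hA hB hy⟩
  have hnA := hcov.torsion_VV hV hN hA (hcov.nabla_vert hN hB hZ.smooth) hx
  have hnB := hcov.torsion_VV hV hN hB (hcov.nabla_vert hN hA hZ.smooth) hx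
  simp only [nabla] at hnA hnB
  simp only [inner_add_left, e1, e2, e3, map_sub, map_add, inner_sub_left, neg_apply,
    inner_neg_left] at hb
  rw [inner_vert_hor (hcov.curvature_vert hN hA hB.smooth hZ.smooth hx) hw,
    inner_vert_hor (hcov.curvature_vert hN hB hZ.smooth hA.smooth hx) hw,
    inner_vert_hor (hcov.cov_mem_vert hN hTV hx _) hw, inner_vert_hor hnA hw,
    inner_vert_hor hnB hw, cov.torsion_antisymm (Z x), inner_neg_left] at hb
  simp only [inner_sub_left]
  linarith

/-- Curvature acts as a derivation on a parallel pairing: the mixed first-order terms of `∇_A ∇_B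
(𝒥(U) Z)` are symmetric in `A` and `B`. -/
theorem curvature_jField (hcov : IsBiquardConnection H cov) (hqc : IsQuaternionicContact h H)
    (he : IsHorizontalFrame H N e)
    (hU : SmoothSection N (vert H) U) (hZ : SmoothSection N H Z) (hA : SmoothField N A)
    (hB : SmoothField N B) (hx : x ∈ N) :
    curvature cov A B (jField H U Z) x =
      jvec H x (curvature cov A B U x) (Z x) + jvec H x (U x) (curvature cov A B Z x) := by
  have hN := he.isOpen
  have key : ∀ {A B : (y : M) → TangentSpace 𝓘(ℝ, E) y}, SmoothField N B →
      cov (nabla cov B (jField H U Z)) x (A x) =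
        jvec H x (cov (nabla cov B U) x (A x)) (Z x) + jvec H x (cov U x (B x)) (cov Z x (A x)) +
        (jvec H x (cov U x (A x)) (cov Z x (B x)) +
          jvec H x (U x) (cov (nabla cov B Z) x (A x))) := by
    intro A B hB
    have hnU := hcov.nabla_vert hN hU hB
    have hnZ := hcov.nabla_hor hN hZ hB
    have h1 := hqc.smoothSection_jField he hnU hZ
    have h2 := hqc.smoothSection_jField he hU hnZ
    have h3 : cov (nabla cov B (jField H U Z)) x =
        cov (jField H (nabla cov B U) Z + jField H U (nabla cov B Z)) x :=
      cov_congr hN (h1.smooth.add h2.smooth) (fun y hy => hcov.cov_jField hN hU hZ hy _) hx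
    rw [h3, cov_add h1.smooth h2.smooth hx, add_apply, hcov.cov_jField hN hnU hZ hx,
      hcov.cov_jField hN hU hnZ hx]
    rfl
  have k1 := key (A := A) hB
  have k2 := key (A := B) hA
  have vA := hcov.cov_mem_vert hN (hcov.nabla_vert hN hU hB) hx (A x)
  have vB := hcov.cov_mem_vert hN (hcov.nabla_vert hN hU hA) hx (B x)
  have vC := hcov.cov_mem_vert hN hU hx (mlieBracket 𝓘(ℝ, E) A B x)
  change cov (nabla cov B (jField H U Z)) x (A x) - cov (nabla cov A (jField H U Z)) x (B x) - _ =
    jvec H x (cov (nabla cov B U) x (A x) - cov (nabla cov A U) x (B x) - _) (Z x) +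
    jvec H x (U x) (cov (nabla cov B Z) x (A x) - cov (nabla cov A Z) x (B x) - _)
  rw [k1, k2, hcov.cov_jField hN hU hZ hx, hqc.jvec_sub_left (sub_mem vA vB) vC,
    hqc.jvec_sub_left vA vB, jvec_sub_right, jvec_sub_right]
  abel

end IsBiquardConnection

end Connection

/-! ### The trace inner product and rotations of a basis -/

section OperatorTraces

variable {W : Type*} [NormedAddCommGroup W] [InnerProductSpace ℝ W] [FiniteDimensional ℝ W]

theorem opInner_add_left (A A' B : W →ₗ[ℝ] W) :
    opInner (A + A') B = opInner A B + opInner A' B := by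
  simp [opInner, LinearMap.comp_add]

theorem opInner_sub_left (A A' B : W →ₗ[ℝ] W) :
    opInner (A - A') B = opInner A B - opInner A' B := by
  simp [opInner, LinearMap.comp_sub]

theorem opInner_smul_left (c : ℝ) (A B : W →ₗ[ℝ] W) : opInner (c • A) B = c * opInner A B := by
  simp [opInner, LinearMap.comp_smul]

theorem opInner_comm (A B : W →ₗ[ℝ] W) : opInner A B = opInner B A := by
  simp only [opInner_eq_sum (stdOrthonormalBasis ℝ W), real_inner_comm]

theorem opInner_adjoint (A B : W →ₗ[ℝ] W) :
    opInner (LinearMap.adjoint A) (LinearMap.adjoint B) = opInner A B := by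
  rw [opInner_comm A B, opInner_eq_trace, opInner_eq_trace, LinearMap.adjoint_adjoint,
    LinearMap.trace_mul_comm]

theorem opInner_skewPart (A : W →ₗ[ℝ] W) {B : W →ₗ[ℝ] W} (hB : LinearMap.adjoint B = -B) :
    opInner (skewPart A) B = opInner A B := by
  have h1 : opInner (LinearMap.adjoint A) B = -opInner A B := by
    rw [← opInner_adjoint, LinearMap.adjoint_adjoint, hB, opInner_comm, ← neg_one_smul ℝ B,
      opInner_smul_left, opInner_comm]
    ring
  rw [skewPart, opInner_smul_left, opInner_sub_left, h1]
  ring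

/-- The derivative of a trace does not see an infinitesimal rotation of the orthonormal basis. -/
theorem sum_inner_rotation {ι : Type*} [Fintype ι] (b : OrthonormalBasis ι ℝ W) (n : ι → W)
    (hn : ∀ i j, inner ℝ (n i) (b j) + inner ℝ (b i) (n j) = 0) (S T : W →ₗ[ℝ] W) :
    ∑ i, (inner ℝ (S (n i)) (T (b i)) + inner ℝ (S (b i)) (T (n i))) = 0 := by
  -- `R` is skew by `hn`, and the sum equals `tr(Tᵀ S R) - tr(R Tᵀ S)`.
  obtain ⟨R, hR⟩ : ∃ R : W →ₗ[ℝ] W, ∀ i, R (b i) = n i :=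
    ⟨b.toBasis.constr ℝ n, fun i => by simpa using b.toBasis.constr_basis ℝ n i⟩
  have hadj : LinearMap.adjoint R = -R := by
    rw [eq_comm, LinearMap.eq_adjoint_iff_basis b.toBasis b.toBasis]
    intro i j
    have := hn i j
    simp only [OrthonormalBasis.coe_toBasis, LinearMap.neg_apply, inner_neg_left, hR]
    linarith
  have h1 : ∑ i, inner ℝ (S (n i)) (T (b i)) = opInner (S ∘ₗ R) T := by
    simp [opInner_eq_sum b, hR]
  have h2 : ∑ i, inner ℝ (S (b i)) (T (n i)) = opInner S (T ∘ₗ R) := by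
    simp [opInner_eq_sum b, hR]
  rw [Finset.sum_add_distrib, h1, h2, opInner, opInner, LinearMap.adjoint_comp, hadj,
    LinearMap.neg_comp, LinearMap.neg_comp, map_neg, ← LinearMap.comp_assoc, LinearMap.trace_comp_comm',
    LinearMap.comp_assoc, add_neg_cancel]

end OperatorTraces

/-! ### Tracing the curvature of `V` over a horizontal frame -/

section CurvatureTrace

variable {E : Type*} [NormedAddCommGroup E] [NormedSpace ℝ E] [FiniteDimensional ℝ E]
  {M : Type*} [TopologicalSpace M] [ChartedSpace E M] [IsManifold 𝓘(ℝ, E) ∞ M]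
  [RiemannianBundle (fun x : M => TangentSpace 𝓘(ℝ, E) x)]
  [IsContMDiffRiemannianBundle 𝓘(ℝ, E) ∞ E (fun x : M => TangentSpace 𝓘(ℝ, E) x)]
  {h : ℕ} {H : (x : M) → Submodule ℝ (TangentSpace 𝓘(ℝ, E) x)}
  {cov : CovariantDerivative 𝓘(ℝ, E) E (TangentSpace 𝓘(ℝ, E) : M → Type _)}
  {N : Set M} {e : Fin h → (y : M) → TangentSpace 𝓘(ℝ, E) y}
  {A B C : (y : M) → TangentSpace 𝓘(ℝ, E) y} {x : M}

theorem mvfderiv_finset_sum {ι : Type*} (s : Finset ι) {f : ι → M → ℝ}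
    (hf : ∀ i ∈ s, MDiffAt (f i) x) :
    MDiffAt (fun y => ∑ i ∈ s, f i y) x ∧
      mvfderiv 𝓘(ℝ, E) (fun y => ∑ i ∈ s, f i y) x = ∑ i ∈ s, mvfderiv 𝓘(ℝ, E) (f i) x := by
  classical
  induction s using Finset.induction_on with
  | empty => exact ⟨by simpa using mdifferentiableAt_const, by simp [mvfderiv_const]⟩
  | insert i s hi ih =>
    obtain ⟨ih1, ih2⟩ := ih fun j hj => hf j (Finset.mem_insert_of_mem hj)
    have hfi := hf i (Finset.mem_insert_self i s)
    simp only [Finset.sum_insert hi]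
    exact ⟨hfi.add ih1, by rw [mvfderiv_fun_add hfi ih1, ih2]⟩

theorem IsQuaternionicContact.opInner_JV (hqc : IsQuaternionicContact h H)
    {u w : TangentSpace 𝓘(ℝ, E) x} (hu : u ∈ vert H x) (hw : w ∈ vert H x) :
    opInner (JV H x u) (JV H x w) = h * inner ℝ u w := by
  have h1 := congrArg (LinearMap.trace ℝ (H x)) (hqc.JV_anticomm hu hw)
  rw [map_add, LinearMap.trace_comp_comm' (JV H x u), map_smul, LinearMap.trace_id,
    hqc.smooth.finrank_eq, smul_eq_mul] at h1
  rw [opInner, hqc.JV_adjoint hw, LinearMap.neg_comp, map_neg,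
    LinearMap.trace_comp_comm' (JV H x u)]
  linarith

theorem SmoothSection.frame (he : IsHorizontalFrame H N e) (i : Fin h) : SmoothSection N H (e i) :=
  ⟨he.smooth i, fun _ hy => he.mem hy i⟩

/-- Rotating an orthonormal frame of `H` by `𝒥(U)`, for `U` of length one. -/
theorem IsQuaternionicContact.frame_jField (hqc : IsQuaternionicContact h H)
    (he : IsHorizontalFrame H N e) (hB : SmoothSection N (vert H) B)
    (hB1 : ∀ y ∈ N, ‖B y‖ = 1) : IsHorizontalFrame H N (fun i => jField H B (e i)) := by
  have hs := fun i => hqc.smoothSection_jField he hB (SmoothSection.frame he i)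
  have hon : ∀ y ∈ N, Orthonormal ℝ (fun i => jField H B (e i) y) := by
    intro y hy
    have hsq := hqc.JV_sq (hB.mem y hy)
    rw [hB1 y hy] at hsq
    have hin : ∀ i j, inner ℝ (jField H B (e i) y) (jField H B (e j) y) =
        inner ℝ (e i y) (e j y) := by
      intro i j
      have h3 : jvec H y (B y) (jvec H y (B y) (e j y)) = -e j y := by
        rw [jvec, jvec, horProj_coe, ← LinearMap.comp_apply, hsq, horProj_of_mem (he.mem hy j)]
        simp
      change inner ℝ (jvec H y (B y) (e i y)) (jvec H y (B y) (e j y)) = _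
      rw [hqc.inner_jvec_left (hB.mem y hy), h3, inner_neg_right, neg_neg]
    have ho := he.orthonormal y hy
    rw [orthonormal_iff_ite] at ho ⊢
    intro i j
    rw [hin, ho]
  refine ⟨he.isOpen, fun i => (hs i).smooth, hon, fun y hy => ?_⟩
  refine Submodule.eq_of_le_of_finrank_eq (Submodule.span_le.2 ?_) ?_
  · rintro _ ⟨i, rfl⟩
    exact (hs i).mem y hy
  · rw [finrank_span_eq_card (hon y hy).linearIndependent, hqc.smooth.finrank_eq,
      Fintype.card_fin]

namespace IsBiquardConnection

theorem coe_torOp (hcov : IsBiquardConnection H cov) {u v : TangentSpace 𝓘(ℝ, E) x}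
    (hu : u ∈ vert H x) (hv : v ∈ H x) :
    (torOp H cov x u (horProj H x v) : TangentSpace 𝓘(ℝ, E) x) = cov.torsion x u v := by
  rw [horProj_of_mem hv]
  exact congrArg Subtype.val (horProj_of_mem (hcov.torsion_VH hu hv))

theorem opInner_torOp_JV (hcov : IsBiquardConnection H cov) (hqc : IsQuaternionicContact h H)
    {u w : TangentSpace 𝓘(ℝ, E) x} (hu : u ∈ vert H x) (hw : w ∈ vert H x) :
    opInner (torOp H cov x u) (JV H x w) = 0 := by
  rw [← opInner_skewPart _ (hqc.JV_adjoint hw)]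
  exact (hcov.torsion_op x u hu).2 _ (innerSL_mem_annih hw)

theorem sum_inner_torsion_jvec (hcov : IsBiquardConnection H cov)
    (hqc : IsQuaternionicContact h H) (he : IsHorizontalFrame H N e) (hx : x ∈ N)
    {u w : TangentSpace 𝓘(ℝ, E) x} (hu : u ∈ vert H x) (hw : w ∈ vert H x) :
    ∑ i, inner ℝ (cov.torsion x u (e i x)) (jvec H x w (e i x)) = 0 := by
  rw [← hcov.opInner_torOp_JV hqc hu hw, he.opInner_eq hx]
  refine Finset.sum_congr rfl fun i _ => ?_
  rw [hcov.coe_torOp hu (he.mem hx i)]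
  rfl

variable [T2Space M]

/-- The relation `⟨Tor(B, ·), 𝒥(C)⟩ = 0` survives differentiation. The term with `∇_v C` is the same
relation again, and the terms with `∇_v e_i` amount to a rotation of the frame. No correction
`Tor(∇_v B, e_i)` is subtracted, as its trace against `𝒥(C)` vanishes too. -/
theorem sum_inner_cov_torField (hcov : IsBiquardConnection H cov)
    (hqc : IsQuaternionicContact h H) (he : IsHorizontalFrame H N e)
    (hB : SmoothSection N (vert H) B) (hC : SmoothSection N (vert H) C) (hx : x ∈ N)
    (v : TangentSpace 𝓘(ℝ, E) x) :
    ∑ i, inner ℝ (cov (torField cov B (e i)) x v - cov.torsion x (B x) (cov (e i) x v))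
      (jvec H x (C x) (e i x)) = 0 := by
  have hN := he.isOpen
  have hei := SmoothSection.frame he
  have hT := fun i => (hcov.torField_VH hN hB (hei i)).smooth
  have hJ := fun i => (hqc.smoothSection_jField he hC (hei i)).smooth
  have hBx := hB.mem x hx
  have hCx := hC.mem x hx
  have hce := fun i => hcov.cov_mem_hor hN (hei i) hx v
  have hsum := (mvfderiv_finset_sum (E := E) Finset.univ fun i _ =>
    ((hT i).inner (hJ i) x hx).mdifferentiableAt (by simp)).2
  have hconst : mvfderiv 𝓘(ℝ, E)
      (fun y => ∑ i, inner ℝ (torField cov B (e i) y) (jField H C (e i) y)) x = 0 :=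
    mvfderiv_eq_zero_of_const hN (fun y hy =>
      hcov.sum_inner_torsion_jvec hqc he hy (hB.mem y hy) (hC.mem y hy)) hx
  rw [hconst] at hsum
  have h1 := congrArg (fun φ => φ v) hsum
  simp only [zero_apply, sum_apply] at h1
  have h2 : ∀ i, mvfderiv 𝓘(ℝ, E)
      (fun y => inner ℝ (torField cov B (e i) y) (jField H C (e i) y)) x v =
      inner ℝ (cov (torField cov B (e i)) x v) (jvec H x (C x) (e i x)) +
      (inner ℝ (cov.torsion x (B x) (e i x)) (jvec H x (cov C x v) (e i x)) +
      inner ℝ (cov.torsion x (B x) (e i x)) (jvec H x (C x) (cov (e i) x v))) := by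
    intro i
    rw [hcov.parallel_metric x _ _ v (hT i x hx) (hJ i x hx), hcov.cov_jField hN hC (hei i) hx,
      inner_add_right]
    rfl
  simp only [h2, Finset.sum_add_distrib] at h1
  rw [hcov.sum_inner_torsion_jvec hqc he hx hBx (hcov.cov_mem_vert hN hC hx v), zero_add] at h1
  have h3 := sum_inner_rotation (he.basis hx) (fun i => horProj H x (cov (e i) x v))
    (fun i j => by
      have hm := hcov.parallel_metric x (e i) (e j) v (he.smooth i x hx) (he.smooth j x hx)
      rw [mvfderiv_eq_zero_of_const hN (fun y hy =>
        orthonormal_iff_ite.1 (he.orthonormal y hy) i j) hx, zero_apply] at hm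
      rw [inner_horProj_left, inner_horProj_right, he.basis_apply, he.basis_apply]
      exact hm.symm) (torOp H cov x (B x)) (JV H x (C x))
  have h4 : ∀ i, inner ℝ (torOp H cov x (B x) (horProj H x (cov (e i) x v)))
      (JV H x (C x) (he.basis hx i)) =
      inner ℝ (cov.torsion x (B x) (cov (e i) x v)) (jvec H x (C x) (e i x)) := by
    intro i
    rw [Submodule.coe_inner, hcov.coe_torOp hBx (hce i), he.basis_apply, jvec,
      horProj_of_mem (he.mem hx i)]
  have h5 : ∀ i, inner ℝ (torOp H cov x (B x) (he.basis hx i))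
      (JV H x (C x) (horProj H x (cov (e i) x v))) =
      inner ℝ (cov.torsion x (B x) (e i x)) (jvec H x (C x) (cov (e i) x v)) := by
    intro i
    rw [Submodule.coe_inner, he.basis_apply, ← horProj_of_mem (he.mem hx i),
      hcov.coe_torOp hBx (he.mem hx i), jvec]
  simp only [h4, h5, Finset.sum_add_distrib] at h3
  simp only [inner_sub_left, Finset.sum_sub_distrib]
  linarith

/-- Of the terms in `bianchi_VVH`, the derivatives of the torsion and `Tor([A, B], ·)` are
orthogonal to `𝒥(C)`; only the commutator contributes. -/
theorem sum_inner_curvature (hcov : IsBiquardConnection H cov) (hqc : IsQuaternionicContact h H)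
    (hV : IsInvolutive (vert H)) (he : IsHorizontalFrame H N e)
    (hA : SmoothSection N (vert H) A) (hB : SmoothSection N (vert H) B)
    (hC : SmoothSection N (vert H) C) (hx : x ∈ N) :
    ∑ i, inner ℝ (curvature cov A B (e i) x) (jvec H x (C x) (e i x)) =
      -opInner (torOp H cov x (A x) ∘ₗ torOp H cov x (B x) -
        torOp H cov x (B x) ∘ₗ torOp H cov x (A x)) (JV H x (C x)) := by
  have hN := he.isOpen
  have hAx := hA.mem x hx
  have hBx := hB.mem x hx
  have hbr := hV x A B (hA.isSectionAt hN hx) (hB.isSectionAt hN hx)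
  have h1 := fun i => hcov.bianchi_VVH hV hN hA hB (SmoothSection.frame he i) hx
    (jvec_mem (C x) (e i x))
  simp only [h1, Finset.sum_sub_distrib]
  rw [hcov.sum_inner_cov_torField hqc he hB hC hx, hcov.sum_inner_cov_torField hqc he hA hC hx,
    hcov.sum_inner_torsion_jvec hqc he hx hbr (hC.mem x hx), he.opInner_eq hx, sub_zero, sub_zero,
    zero_sub]
  congr 1
  refine Finset.sum_congr rfl fun i _ => ?_
  have hi := he.mem hx i
  have hc : ∀ {u w : TangentSpace 𝓘(ℝ, E) x}, u ∈ vert H x → w ∈ vert H x →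
      ((torOp H cov x u (torOp H cov x w (horProj H x (e i x))) : H x) : TangentSpace 𝓘(ℝ, E) x) =
        cov.torsion x u (cov.torsion x w (e i x)) := by
    intro u w hu hw
    rw [← hcov.coe_torOp hw hi, ← hcov.coe_torOp hu (Subtype.prop _), horProj_coe]
  rw [LinearMap.sub_apply, LinearMap.comp_apply, LinearMap.comp_apply, Submodule.coe_sub,
    hc hAx hBx, hc hBx hAx]
  rfl

/-- The curvature of `V` in terms of the commutator of the torsion operators. -/
theorem inner_curvature_eq (hcov : IsBiquardConnection H cov) (hqc : IsQuaternionicContact h H)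
    (hV : IsInvolutive (vert H)) (he : IsHorizontalFrame H N e)
    (hA : SmoothSection N (vert H) A) (hB : SmoothSection N (vert H) B)
    (hC : SmoothSection N (vert H) C) (hB1 : ∀ y ∈ N, ‖B y‖ = 1) (hx : x ∈ N)
    (hAB : inner ℝ (A x) (B x) = 0) (hABC : JV H x (A x) ∘ₗ JV H x (B x) = JV H x (C x)) :
    h * inner ℝ (curvature cov A B B x) (A x) =
      2 * opInner (torOp H cov x (A x) ∘ₗ torOp H cov x (B x) -
        torOp H cov x (B x) ∘ₗ torOp H cov x (A x)) (JV H x (C x)) := by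
  have hN := he.isOpen
  have hAx := hA.mem x hx
  have hBx := hB.mem x hx
  -- The trace of `[R(A, B), 𝒥(B)]` against `𝒥(A)` splits into two traces against `𝒥(C)`, one over
  -- `e_i` and one over the rotated frame `𝒥(B) e_i`. Each gives the same commutator, whence the
  -- factor two.
  have he' := hqc.frame_jField he hB hB1
  have hBA : JV H x (B x) ∘ₗ JV H x (A x) = -JV H x (C x) := by
    have := hqc.JV_anticomm hAx hBx
    rw [hAB, hABC] at this
    simpa using eq_neg_of_add_eq_zero_right (this.trans (by simp))
  have hBB : JV H x (B x) ∘ₗ JV H x (B x) = -LinearMap.id := by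
    rw [hqc.JV_sq hBx, hB1 x hx, one_pow]
    exact neg_one_smul ℝ (LinearMap.id : H x →ₗ[ℝ] H x)
  have s1 := hcov.sum_inner_curvature hqc hV he hA hB hC hx
  have s2 := hcov.sum_inner_curvature hqc hV he' hA hB hC hx
  rw [← hqc.opInner_JV (hcov.curvature_vert hN hB hA.smooth hB.smooth hx) hAx, he.opInner_eq hx]
  have key : ∀ i, inner ℝ
      (JV H x (curvature cov A B B x) (horProj H x (e i x)) : TangentSpace 𝓘(ℝ, E) x)
      (JV H x (A x) (horProj H x (e i x)) : TangentSpace 𝓘(ℝ, E) x) =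
      -inner ℝ (curvature cov A B (jField H B (e i)) x) (jvec H x (C x) (jField H B (e i) x)) -
      inner ℝ (curvature cov A B (e i) x) (jvec H x (C x) (e i x)) := by
    intro i
    have h1 := hcov.curvature_jField hqc he hB (SmoothSection.frame he i) hA.smooth hB.smooth hx
    have h2 : jvec H x (C x) (jField H B (e i) x) = -jvec H x (A x) (e i x) := by
      change jvec H x (C x) (jvec H x (B x) (e i x)) = _
      simp only [jvec, horProj_coe]
      rw [← LinearMap.comp_apply, ← hABC, LinearMap.comp_assoc, hBB]
      simp
    have h3 : jvec H x (B x) (jvec H x (A x) (e i x)) = -jvec H x (C x) (e i x) := by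
      simp only [jvec, horProj_coe]
      rw [← LinearMap.comp_apply, hBA]
      simp
    change inner ℝ (jvec H x (curvature cov A B B x) (e i x)) (jvec H x (A x) (e i x)) = _
    rw [h1, h2, inner_neg_right, inner_add_left, hqc.inner_jvec_left hBx, h3, inner_neg_right]
    ring
  simp only [key, Finset.sum_sub_distrib, Finset.sum_neg_distrib]
  rw [s1]
  rw [s2]
  ring

end IsBiquardConnection

end CurvatureTrace

/-! ### Algebra of operators commuting or anticommuting with complex structures -/

section QuaternionicAlgebra

variable {W : Type*} [NormedAddCommGroup W] [InnerProductSpace ℝ W] [FiniteDimensional ℝ W]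

theorem eq_zero_of_add_self {G : Type*} [AddCommGroup G] [Module ℝ G] {v : G} (hv : v + v = 0) :
    v = 0 := by
  rw [← two_smul ℝ, smul_eq_zero] at hv
  exact hv.resolve_left two_ne_zero

theorem trace_mul_eq (A B : Module.End ℝ W) :
    LinearMap.trace ℝ W (A * B) = LinearMap.trace ℝ W (B * A) :=
  LinearMap.trace_mul_comm ℝ A B

/-- Conjugation by `J` sends `Z` to `-Z` and preserves the trace. -/
theorem trace_eq_zero_of_anticomm {J Z : Module.End ℝ W} (hJ : J * J = -1)
    (hZ : J * Z = -(Z * J)) : LinearMap.trace ℝ W Z = 0 := by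
  have h1 : J * (J * Z) = -Z := by rw [← mul_assoc, hJ, neg_one_mul]
  have h2 : J * Z * J = Z := by rw [hZ, neg_mul, mul_assoc, hJ, mul_neg_one, neg_neg]
  have h3 := trace_mul_eq J (J * Z)
  rw [h1, h2, map_neg] at h3
  linarith

theorem symPart_adjoint (A : W →ₗ[ℝ] W) : LinearMap.adjoint (symPart A) = symPart A := by
  simp [symPart, add_comm]

theorem skewPart_adjoint (A : W →ₗ[ℝ] W) : LinearMap.adjoint (skewPart A) = -skewPart A := by
  simp [skewPart, ← smul_neg]

theorem symPart_add_skewPart (A : W →ₗ[ℝ] W) : symPart A + skewPart A = A := by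
  simp only [symPart, skewPart]
  module

theorem adjoint_eq_symPart_sub_skewPart (A : W →ₗ[ℝ] W) :
    LinearMap.adjoint A = symPart A - skewPart A := by
  simp only [symPart, skewPart]
  module

theorem symPart_map_add (A B : W →ₗ[ℝ] W) : symPart (A + B) = symPart A + symPart B := by
  simp only [symPart, map_add]
  module

theorem skewPart_map_add (A B : W →ₗ[ℝ] W) : skewPart (A + B) = skewPart A + skewPart B := by
  simp only [skewPart, map_add]
  module

theorem two_commPart (J A : Module.End ℝ W) :
    commPart J A + commPart J A = A - J * (A * J) := by
  rw [commPart, ← two_smul ℝ, smul_smul]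
  norm_num
  rfl

theorem commPart_adjoint {J A : Module.End ℝ W} (hJ : LinearMap.adjoint J = -J)
    (hA : LinearMap.adjoint A = A) : LinearMap.adjoint (commPart J A) = commPart J A := by
  have h1 : LinearMap.adjoint (J * (A * J)) = J * (A * J) := by
    rw [adjoint_mul, adjoint_mul, hJ, hA]
    noncomm_ring
  change LinearMap.adjoint ((1 / 2 : ℝ) • (A - J * (A * J))) = (1 / 2 : ℝ) • (A - J * (A * J))
  rw [map_smulₛₗ, map_sub, h1, hA]
  rfl

/-- If `Tᵀ J + J T = K` with `K` anticommuting with `J` and the skew part of `T` orthogonal to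
`K J`, then the symmetric part of `T` anticommutes with `J` and the skew part commutes with it. -/
theorem sym_anticomm_skew_comm {J K T : Module.End ℝ W} {r : ℝ} (hr : r ≠ 0)
    (hJ2 : J * J = -r • 1) (hJ : LinearMap.adjoint J = -J) (hK : LinearMap.adjoint K = -K)
    (hKJ : K * J = -(J * K)) (hT : LinearMap.adjoint T * J + J * T = K)
    (horth : opInner (skewPart T) (K * J) = 0) :
    symPart T * J + J * symPart T = 0 ∧ skewPart T * J = J * skewPart T := by
  obtain ⟨S, hS⟩ : ∃ S : Module.End ℝ W, symPart T = S := ⟨_, rfl⟩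
  obtain ⟨A, hA⟩ : ∃ A : Module.End ℝ W, skewPart T = A := ⟨_, rfl⟩
  have hTS : T = S + A := by rw [← hS, ← hA, symPart_add_skewPart]
  have hTA : LinearMap.adjoint T = S - A := by
    rw [adjoint_eq_symPart_sub_skewPart, hS, hA]
  rw [hTA, hTS] at hT
  rw [hS, hA]
  rw [hA] at horth
  have hc : ∀ X : Module.End ℝ W, J * (J * X) = X * J * J := by
    intro X
    rw [← mul_assoc, mul_assoc X, hJ2]
    simp
  have hP : S * J + J * S = K - (J * A - A * J) := by rw [← hT]; noncomm_ring
  -- `SJ + JS` commutes with `J` because `J²` is scalar. It also equals `K - [J, A]`, which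
  -- anticommutes with `J`, so it must vanish.
  have hcomm : J * (S * J + J * S) = (S * J + J * S) * J := by
    rw [mul_add, add_mul, hc S]
    noncomm_ring
  have hanti : J * (S * J + J * S) = -((S * J + J * S) * J) := by
    have h1 : J * (K - (J * A - A * J)) + (K - (J * A - A * J)) * J =
      (J * K + K * J) - (J * (J * A) - A * J * J) := by noncomm_ring
    rw [hP, eq_neg_iff_add_eq_zero, h1, hc A, hKJ]
    simp
  have h0 : J * (S * J + J * S) = 0 := by
    refine eq_zero_of_add_self ?_
    nth_rewrite 2 [hanti]
    rw [← hcomm, add_neg_cancel]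
  have hS0 : S * J + J * S = 0 := by
    have h1 := congrArg (J * ·) h0
    simp only [← mul_assoc J J, hJ2, mul_zero, smul_mul_assoc, one_mul] at h1
    exact (smul_eq_zero.1 h1).resolve_left (neg_ne_zero.2 hr)
  refine ⟨hS0, ?_⟩
  have hKA : K = J * A - A * J := by
    rw [hS0] at hP
    exact sub_eq_zero.1 hP.symm
  -- With `K = [J, A]`, cyclicity of the trace gives `⟨K, K⟩ = 2⟨A, K J⟩`, which is zero by
  -- hypothesis.
  have hKK : opInner K K = 0 := by
    have h1 : opInner A (K * J) = -LinearMap.trace ℝ W (K * J * A) := by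
      rw [opInner_eq_trace, adjoint_mul, hJ, hK, hKJ, neg_mul_neg, ← map_neg]
      congr 1
      noncomm_ring
    have h2 : opInner K K = -LinearMap.trace ℝ W (K * J * A) - LinearMap.trace ℝ W (K * J * A) := by
      rw [opInner_eq_trace, hK]
      nth_rewrite 2 [hKA]
      have h3 : -K * (J * A - A * J) = -(K * J * A) + K * A * J := by noncomm_ring
      have h4 : J * (K * A) = -(K * J * A) := by rw [hKJ]; noncomm_ring
      rw [h3, map_add, trace_mul_eq (K * A) J, h4, map_neg]
      ring
    linarith
  rw [opInner_self_eq_zero.1 hKK] at hKA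
  exact (sub_eq_zero.1 hKA.symm).symm

/-- A skew operator orthogonal to the component of it that commutes with `J` anticommutes
with `J`. -/
theorem anticomm_of_orthogonal {J A : Module.End ℝ W} (hJ2 : J * J = -1)
    (hJ : LinearMap.adjoint J = -J) (hA : LinearMap.adjoint A = -A)
    (horth : opInner A (A - J * A * J) = 0) : A * J = -(J * A) := by
  set B := A - J * A * J with hB
  have hJJ : ∀ X : Module.End ℝ W, J * (J * X) = -X := by
    intro X
    rw [← mul_assoc, hJ2, neg_one_mul]
  have hBJ : J * B = B * J := by
    have h1 : J * B = J * A - J * (J * (A * J)) := by rw [hB]; noncomm_ring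
    have h2 : B * J = A * J - J * A * (J * J) := by rw [hB]; noncomm_ring
    rw [h1, h2, hJJ, hJ2]
    noncomm_ring
  have hBadj : LinearMap.adjoint B = -B := by
    rw [hB, map_sub, adjoint_mul, adjoint_mul, hA, hJ]
    noncomm_ring
  -- `B` is twice the projection of `A` to the commutant of `J`, so `⟨B, B⟩ = 2⟨A, B⟩`.
  have hBB : opInner B B = 0 := by
    have h1 : opInner (J * A * J) B = -opInner A B := by
      have h2 : J * (B * (J * A)) = -(B * A) := by
        rw [← mul_assoc, hBJ, mul_assoc, hJJ, mul_neg]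
      have h3 : -B * (J * A * J) = -(B * (J * A) * J) := by noncomm_ring
      rw [opInner_eq_trace, opInner_eq_trace, hBadj, h3, map_neg, trace_mul_eq _ J, h2, neg_mul,
        map_neg]
    nth_rewrite 1 [hB]
    rw [opInner_sub_left, h1, horth]
    simp
  have h0 : A - J * A * J = 0 := opInner_self_eq_zero.1 hBB
  have h1 := congrArg (J * ·) h0
  have h2 : J * (A - J * A * J) = J * A - J * (J * (A * J)) := by noncomm_ring
  simp only [h2, hJJ, mul_zero, sub_neg_eq_add] at h1
  exact eq_neg_of_add_eq_zero_right h1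

section Commutator

variable {J K : Module.End ℝ W}

theorem opInner_mul_left_of_sq {L : Module.End ℝ W} (hL : LinearMap.adjoint L * L = 1)
    (A : Module.End ℝ W) : opInner (L * A) (L * A) = opInner A A := by
  rw [opInner_eq_trace, opInner_eq_trace, adjoint_mul, mul_assoc, ← mul_assoc _ L, hL, one_mul]

/-- Commutator of the skew parts of the torsion operators along two orthogonal directions. -/
theorem skew_commutator (hJ2 : J * J = -1) (hK2 : K * K = -1) (hJK : K * J = -(J * K))
    (hJ : LinearMap.adjoint J = -J) (hK : LinearMap.adjoint K = -K) {A B : Module.End ℝ W}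
    (hA : LinearMap.adjoint A = -A) (hAJ : A * J = J * A) (hAK : A * K = -(K * A))
    (hBJ : B * J = -(J * B))
    (hAB : A * K - K * A + (B * J - J * B) = 0) :
    opInner B B = opInner A A ∧ opInner (A * B - B * A) (J * K) = 2 * opInner A A := by
  have hLL : (J * K) * (J * K) = -1 := by
    calc (J * K) * (J * K) = J * (K * J) * K := by noncomm_ring
      _ = -(J * J * (K * K)) := by rw [hJK]; noncomm_ring
      _ = -1 := by rw [hJ2, hK2]; simp
  have hLadj : LinearMap.adjoint (J * K) = -(J * K) := by
    rw [adjoint_mul, hJ, hK, neg_mul_neg, hJK]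
  have hLA : A * (J * K) = -(J * K * A) := by
    rw [← mul_assoc, hAJ, mul_assoc, hAK]
    noncomm_ring
  have hB : B = (J * K) * A := by
    have h1 : J * B = -(K * A) := by
      have h2 : (J * B + K * A) + (J * B + K * A) = 0 := by
        rw [← neg_eq_zero, ← hAB, hAK, hBJ]
        noncomm_ring
      exact eq_neg_of_add_eq_zero_left (eq_zero_of_add_self h2)
    have h3 := congrArg (J * ·) h1
    simp only [← mul_assoc, hJ2, neg_one_mul, mul_neg] at h3
    exact neg_injective h3
  have hAA : LinearMap.trace ℝ W (A * A) = -opInner A A := by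
    rw [opInner_eq_trace, hA, neg_mul, map_neg, neg_neg]
  refine ⟨?_, ?_⟩
  · rw [hB]
    exact opInner_mul_left_of_sq (by rw [hLadj, neg_mul, hLL, neg_neg]) A
  · set L := J * K
    -- With `B = L A` and `A L = -L A`, both halves of the commutator contribute `L² A² = -A²`.
    have h1 : -L * (A * B - B * A) = (2 : ℝ) • -(A * A) := by
      calc -L * (A * B - B * A) = L * L * (A * A) - L * (A * L) * A := by rw [hB]; noncomm_ring
        _ = L * L * (A * A) + L * L * (A * A) := by rw [hLA]; noncomm_ring
        _ = (2 : ℝ) • -(A * A) := by rw [hLL, two_smul]; noncomm_ring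
    rw [opInner_eq_trace, hLadj, h1, map_smul, map_neg, hAA, neg_neg, smul_eq_mul]

/-- Commutator of the symmetric parts of the torsion operators along two orthogonal directions. -/
theorem sym_commutator (hJ2 : J * J = -1) (hK2 : K * K = -1) (hJK : K * J = -(J * K))
    (hJ : LinearMap.adjoint J = -J) (hK : LinearMap.adjoint K = -K) {S R : Module.End ℝ W}
    (hS : LinearMap.adjoint S = S) (hSJ : S * J + J * S = 0)
    (hRK : R * K + K * R = 0) (hSR : S * K + K * S + (R * J + J * R) = 0) :
    opInner (commPart J R) (commPart J R) = opInner (commPart K S) (commPart K S) ∧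
      opInner (S * R - R * S) (J * K) = -(2 * opInner (commPart K S) (commPart K S)) := by
  have hLL : (J * K) * (J * K) = -1 := by
    calc (J * K) * (J * K) = J * (K * J) * K := by noncomm_ring
      _ = -(J * J * (K * K)) := by rw [hJK]; noncomm_ring
      _ = -1 := by rw [hJ2, hK2]; simp
  have hLadj : LinearMap.adjoint (J * K) = -(J * K) := by
    rw [adjoint_mul, hJ, hK, neg_mul_neg, hJK]
  have hPadj := commPart_adjoint hK hS
  obtain ⟨P, hP⟩ : ∃ P : Module.End ℝ W, commPart K S = P := ⟨_, rfl⟩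
  obtain ⟨Q, hQ⟩ : ∃ Q : Module.End ℝ W, commPart J R = Q := ⟨_, rfl⟩
  have hP2 := two_commPart K S
  have hQ2 := two_commPart J R
  rw [hP] at hP2 hPadj
  rw [hQ] at hQ2
  rw [hP, hQ]
  have hJJ : ∀ X : Module.End ℝ W, J * (J * X) = -X := fun X => by
    rw [← mul_assoc, hJ2, neg_one_mul]
  have hKK : ∀ X : Module.End ℝ W, K * (K * X) = -X := fun X => by
    rw [← mul_assoc, hK2, neg_one_mul]
  have hKJ : ∀ X : Module.End ℝ W, K * (J * X) = -(J * (K * X)) := fun X => by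
    rw [← mul_assoc, hJK, neg_mul, mul_assoc]
  have hSJ' : J * S = -(S * J) := eq_neg_of_add_eq_zero_right hSJ
  have hRK' : K * R = -(R * K) := eq_neg_of_add_eq_zero_right hRK
  have hPK : K * P = P * K := by
    rw [← sub_eq_zero]
    refine eq_zero_of_add_self ?_
    have h1 : K * P - P * K + (K * P - P * K) = K * (P + P) - (P + P) * K := by noncomm_ring
    have h2 : (S - K * (S * K)) * K = S * K - K * S * (K * K) := by noncomm_ring
    rw [h1, hP2, h2, mul_sub, hKK, hK2]
    noncomm_ring
  have hPJ : J * P = -(P * J) := by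
    rw [← add_eq_zero_iff_eq_neg]
    refine eq_zero_of_add_self ?_
    have h1 : J * P + P * J + (J * P + P * J) = J * (P + P) + (P + P) * J := by noncomm_ring
    have h2 : J * (S - K * (S * K)) + (S - K * (S * K)) * J =
      (J * S + S * J) - (J * K * S * K + K * S * (K * J)) := by noncomm_ring
    have h3 : J * K * S * K + K * S * (K * J) = -(K * (J * S + S * J) * K) := by
      have h4 : K * (J * S + S * J) * K = K * J * S * K + K * S * (J * K) := by noncomm_ring
      rw [h4, hJK]
      noncomm_ring
    rw [h1, hP2, h2, h3, add_comm (J * S), hSJ]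
    simp
  have hQJ : J * Q = Q * J := by
    rw [← sub_eq_zero]
    refine eq_zero_of_add_self ?_
    have h1 : J * Q - Q * J + (J * Q - Q * J) = J * (Q + Q) - (Q + Q) * J := by noncomm_ring
    have h2 : (R - J * (R * J)) * J = R * J - J * R * (J * J) := by noncomm_ring
    rw [h1, hQ2, h2, mul_sub, hJJ, hJ2]
    noncomm_ring
  -- The polarized relation `hSR` says `J Q + K P = 0`: multiplying by `J` or `K` turns the doubled
  -- commuting parts into the anticommutators in it.
  have hQP : Q = (J * K) * P := by
    have h1 : J * Q + K * P = 0 := by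
      refine eq_zero_of_add_self ?_
      have h2 : J * Q + K * P + (J * Q + K * P) = J * (Q + Q) + K * (P + P) := by noncomm_ring
      rw [h2, hP2, hQ2, mul_sub, mul_sub, hJJ, hKK, ← hSR]
      noncomm_ring
    have h3 := congrArg (J * ·) h1
    simp only [mul_add, hJJ, mul_zero] at h3
    rw [mul_assoc]
    exact neg_injective (eq_neg_of_add_eq_zero_left h3)
  have hQK : K * Q = -(Q * K) := by
    rw [hQP, mul_assoc, hKJ, mul_assoc, mul_assoc, ← hPK]
  refine ⟨?_, ?_⟩
  · rw [hQP]
    exact opInner_mul_left_of_sq (by rw [hLadj, neg_mul, hLL, neg_neg]) P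
  · have hLJ : J * (J * K) = -((J * K) * J) := by rw [mul_assoc, hJK, mul_neg, neg_neg]
    have hLK : K * (J * K) = -((J * K) * K) := by rw [← mul_assoc, hJK, neg_mul]
    have hLP : P * (J * K) = -((J * K) * P) := by
      rw [mul_assoc, hPK, ← mul_assoc, ← mul_assoc, hPJ, neg_mul, neg_neg]
    set L := J * K
    -- `S'` and `R'` are the complementary parts, anticommuting with both `J` and `K`.
    obtain ⟨S', rfl⟩ : ∃ S', S = P + S' := ⟨S - P, by abel⟩
    obtain ⟨R', rfl⟩ : ∃ R', R = Q + R' := ⟨R - Q, by abel⟩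
    have hS'J : J * S' = -(S' * J) := by
      have h1 := hSJ'
      rw [mul_add, add_mul, hPJ, neg_add] at h1
      exact add_left_cancel h1
    have hR'K : K * R' = -(R' * K) := by
      have h1 := hRK'
      rw [mul_add, add_mul, hQK, neg_add] at h1
      exact add_left_cancel h1
    have hS'K : K * S' = -(S' * K) := by
      have h1 : P = S' - K * (P * K) - K * (S' * K) := by
        have h2 : P + P = P + (S' - K * (P * K) - K * (S' * K)) := by rw [hP2]; noncomm_ring
        exact add_left_cancel h2
      have h3 : K * (P * K) = -P := by rw [← hPK, hKK]
      rw [h3] at h1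
      have h4 : S' = K * (S' * K) := by
        have h5 : S' - K * (S' * K) = 0 := by
          have h6 : S' - K * (S' * K) = (S' - -P - K * (S' * K)) - P := by abel
          rw [h6, ← h1, sub_self]
        exact sub_eq_zero.1 h5
      have h7 := congrArg (K * ·) h4
      simpa only [hKK] using h7
    have hR'J : J * R' = -(R' * J) := by
      have h1 : Q = R' - J * (Q * J) - J * (R' * J) := by
        have h2 : Q + Q = Q + (R' - J * (Q * J) - J * (R' * J)) := by rw [hQ2]; noncomm_ring
        exact add_left_cancel h2
      have h3 : J * (Q * J) = -Q := by rw [← hQJ, hJJ]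
      rw [h3] at h1
      have h4 : R' = J * (R' * J) := by
        have h5 : R' - J * (R' * J) = 0 := by
          have h6 : R' - J * (R' * J) = (R' - -Q - J * (R' * J)) - Q := by abel
          rw [h6, ← h1, sub_self]
        exact sub_eq_zero.1 h5
      have h7 := congrArg (J * ·) h4
      simpa only [hJJ] using h7
    have anti3 : ∀ {F X Y Z : Module.End ℝ W}, F * X = -(X * F) → F * Y = -(Y * F) →
        F * Z = -(Z * F) → F * (X * (Y * Z)) = -(X * (Y * Z) * F) := by
      intro F X Y Z hX hY hZ
      calc F * (X * (Y * Z)) = F * X * Y * Z := by noncomm_ring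
        _ = -(X * (F * Y) * Z) := by rw [hX]; noncomm_ring
        _ = X * Y * (F * Z) := by rw [hY]; noncomm_ring
        _ = -(X * (Y * Z) * F) := by rw [hZ]; noncomm_ring
    -- Every product except those of `P` and `Q` has three factors anticommuting with the same
    -- complex structure (`J`, or `K` when `S'` meets `Q`), hence is trace free.
    have t1 := trace_eq_zero_of_anticomm hJ2 (anti3 hLJ hPJ hR'J)
    have t2 := trace_eq_zero_of_anticomm hJ2 (anti3 hLJ hR'J hPJ)
    have t3 := trace_eq_zero_of_anticomm hK2 (anti3 hLK hS'K hQK)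
    have t4 := trace_eq_zero_of_anticomm hK2 (anti3 hLK hQK hS'K)
    have t5 := trace_eq_zero_of_anticomm hJ2 (anti3 hLJ hS'J hR'J)
    have t6 := trace_eq_zero_of_anticomm hJ2 (anti3 hLJ hR'J hS'J)
    have h1 : L * (P * Q) = P * P := by
      rw [hQP, ← mul_assoc P, hLP]
      calc L * (-(L * P) * P) = -(L * L) * (P * P) := by noncomm_ring
        _ = P * P := by rw [hLL, neg_neg, one_mul]
    have h2 : L * (Q * P) = -(P * P) := by
      rw [hQP]
      calc L * (L * P * P) = (L * L) * (P * P) := by noncomm_ring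
        _ = -(P * P) := by rw [hLL, neg_one_mul]
    have h3 : -L * ((P + S') * (Q + R') - (Q + R') * (P + S')) =
        -(L * (P * Q)) + L * (Q * P) - L * (P * R') + L * (R' * P) - L * (S' * Q) + L * (Q * S')
          - L * (S' * R') + L * (R' * S') := by noncomm_ring
    rw [opInner_eq_trace, opInner_eq_trace, hLadj, hPadj, h3, h1, h2]
    simp only [map_add, map_sub, map_neg, t1, t2, t3, t4, t5, t6]
    ring

/-- The commutator of a symmetric and a skew operator is orthogonal to the skew operators. -/
theorem opInner_sym_skew_commutator {S A L : Module.End ℝ W} (hS : LinearMap.adjoint S = S)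
    (hA : LinearMap.adjoint A = -A) (hL : LinearMap.adjoint L = -L) :
    opInner (S * A - A * S) L = 0 := by
  have h1 : LinearMap.adjoint (S * A - A * S) = S * A - A * S := by
    rw [map_sub, adjoint_mul, adjoint_mul, hS, hA]
    noncomm_ring
  have h2 := opInner_skewPart (S * A - A * S) hL
  rw [← h2, skewPart, h1]
  simp [opInner]

end Commutator

end QuaternionicAlgebra

/-! ### Combining two torsion operators -/

section PairAlgebra

variable {W : Type*} [NormedAddCommGroup W] [InnerProductSpace ℝ W] [FiniteDimensional ℝ W]

theorem opInner_add_right (A B B' : W →ₗ[ℝ] W) :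
    opInner A (B + B') = opInner A B + opInner A B' := by
  rw [opInner_comm, opInner_add_left, opInner_comm B, opInner_comm B']

theorem opInner_smul_right (c : ℝ) (A B : W →ₗ[ℝ] W) : opInner A (c • B) = c * opInner A B := by
  rw [opInner_comm, opInner_smul_left, opInner_comm]

theorem opInner_neg_one_of_skew {A : Module.End ℝ W} (hA : LinearMap.adjoint A = -A) :
    opInner A (-1 : Module.End ℝ W) = 0 := by
  have h1 := opInner_adjoint A (-1 : Module.End ℝ W)
  have h2 : LinearMap.adjoint (-1 : Module.End ℝ W) = -1 := by
    rw [map_neg]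
    exact congrArg _ LinearMap.adjoint_id
  rw [h2, hA, ← neg_one_smul ℝ A, opInner_smul_left] at h1
  linarith

theorem quaternion_table {I K L : Module.End ℝ W} (hI : I * I = -1) (hL : L * L = -1)
    (hIKL : I * (K * L) = -1) (hLI : L * I = -(I * L)) : I * K = L ∧ K * L = I ∧ L * I = K := by
  have e01 : I * K = L := by
    have h := congrArg (· * L) hIKL
    simp only [mul_assoc, hL] at h
    simpa using h
  have e12 : K * L = I := by
    have h := congrArg (I * ·) hIKL
    simp only [← mul_assoc, hI] at h
    simpa using h
  refine ⟨e01, e12, ?_⟩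
  rw [hLI, ← e01, ← mul_assoc, hI, neg_one_mul, neg_neg]

theorem opNorm_sq (A : W →ₗ[ℝ] W) : opNorm A ^ 2 = opInner A A := by
  rw [opNorm, Real.sq_sqrt]
  rw [opInner_eq_sum (stdOrthonormalBasis ℝ W)]
  exact Finset.sum_nonneg fun i _ => real_inner_self_nonneg

/-- The operators `T_a`, `T_b` along two orthogonal directions: equality of the norms of the
components, and the trace of the commutator. -/
theorem torsion_pair {J K S T : Module.End ℝ W} (hJ2 : J * J = -1) (hK2 : K * K = -1)
    (hJK : K * J = -(J * K)) (hJ : LinearMap.adjoint J = -J) (hK : LinearMap.adjoint K = -K)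
    (hS : symPart S * J + J * symPart S = 0 ∧ skewPart S * J = J * skewPart S)
    (hT : symPart T * K + K * symPart T = 0 ∧ skewPart T * K = K * skewPart T)
    (hST : symPart (S + T) * (J + K) + (J + K) * symPart (S + T) = 0 ∧
      skewPart (S + T) * (J + K) = (J + K) * skewPart (S + T))
    (hSK : skewPart S * K = -(K * skewPart S)) (hTJ : skewPart T * J = -(J * skewPart T)) :
    opInner (skewPart T) (skewPart T) = opInner (skewPart S) (skewPart S) ∧
      opInner (commPart J (symPart T)) (commPart J (symPart T)) =
        opInner (commPart K (symPart S)) (commPart K (symPart S)) ∧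
      opInner (S * T - T * S) (J * K) = 2 * opInner (skewPart S) (skewPart S) -
        2 * opInner (commPart K (symPart S)) (commPart K (symPart S)) := by
  have hLadj : LinearMap.adjoint (J * K) = -(J * K) := by
    rw [adjoint_mul, hJ, hK, neg_mul_neg, hJK]
  rw [symPart_map_add, skewPart_map_add] at hST
  have eS := symPart_add_skewPart S
  have eT := symPart_add_skewPart T
  have aS := symPart_adjoint S
  have aT := symPart_adjoint T
  have bS := skewPart_adjoint S
  have bT := skewPart_adjoint T
  generalize symPart S = S₁ at *
  generalize symPart T = T₁ at *
  generalize skewPart S = S₂ at *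
  generalize skewPart T = T₂ at *
  -- Polarization: subtract the relations for each direction from the one for the sum.
  have hsym : S₁ * K + K * S₁ + (T₁ * J + J * T₁) = 0 := by
    have h1 : (S₁ + T₁) * (J + K) + (J + K) * (S₁ + T₁) = (S₁ * J + J * S₁) + (T₁ * K + K * T₁) +
      (S₁ * K + K * S₁ + (T₁ * J + J * T₁)) := by noncomm_ring
    rw [h1, hS.1, hT.1] at hST
    simpa using hST.1
  have hskew : S₂ * K - K * S₂ + (T₂ * J - J * T₂) = 0 := by
    have h1 : (S₂ + T₂) * (J + K) - (J + K) * (S₂ + T₂) = (S₂ * J - J * S₂) + (T₂ * K - K * T₂) +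
      (S₂ * K - K * S₂ + (T₂ * J - J * T₂)) := by noncomm_ring
    rw [sub_eq_zero.2 hST.2, sub_eq_zero.2 hS.2, sub_eq_zero.2 hT.2] at h1
    simpa using h1.symm
  obtain ⟨h1, h2⟩ := skew_commutator hJ2 hK2 hJK hJ hK bS hS.2 hSK hTJ hskew
  obtain ⟨h3, h4⟩ := sym_commutator hJ2 hK2 hJK hJ hK aS hS.1 hT.1 hsym
  refine ⟨h1, h3, ?_⟩
  -- The mixed commutators of a symmetric and a skew operator are symmetric, so they drop out
  -- against the skew `J K`.
  have h5 : S * T - T * S = (S₁ * T₁ - T₁ * S₁) + (S₂ * T₂ - T₂ * S₂) + (S₁ * T₂ - T₂ * S₁) -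
      (T₁ * S₂ - S₂ * T₁) := by
    rw [← eS, ← eT]
    noncomm_ring
  rw [h5, opInner_sub_left, opInner_add_left, opInner_add_left, h2, h4,
    opInner_sym_skew_commutator aS bT hLadj, opInner_sym_skew_commutator aT bS hLadj]
  ring

end PairAlgebra

/-! ### Vertical frames and their multiplication table -/

section Main

variable {E : Type*} [NormedAddCommGroup E] [NormedSpace ℝ E] [FiniteDimensional ℝ E]
  {M : Type*} [TopologicalSpace M] [ChartedSpace E M] [IsManifold 𝓘(ℝ, E) ∞ M]
  [RiemannianBundle (fun x : M => TangentSpace 𝓘(ℝ, E) x)]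
  [IsContMDiffRiemannianBundle 𝓘(ℝ, E) ∞ E (fun x : M => TangentSpace 𝓘(ℝ, E) x)]
  {h : ℕ} {H : (x : M) → Submodule ℝ (TangentSpace 𝓘(ℝ, E) x)}
  {cov : CovariantDerivative 𝓘(ℝ, E) E (TangentSpace 𝓘(ℝ, E) : M → Type _)}
  {N O : Set M} {e : Fin h → (y : M) → TangentSpace 𝓘(ℝ, E) y}
  {U : Fin 3 → (y : M) → TangentSpace 𝓘(ℝ, E) y}
  {A : (y : M) → TangentSpace 𝓘(ℝ, E) y} {x : M}

/-- Constant coefficients in the frame extend `v` over the whole of `N`, so that different vectors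
get sections on a common open set. -/
theorem IsHorizontalFrame.exists_smoothSection (he : IsHorizontalFrame H N e) (hx : x ∈ N)
    {v : TangentSpace 𝓘(ℝ, E) x} (hv : v ∈ H x) : ∃ X, SmoothSection N H X ∧ X x = v := by
  refine ⟨fun y => ∑ i, (inner ℝ v (e i x) • e i) y, ⟨SmoothField.sum fun i _ =>
    (he.smooth i).const_smul _, fun y hy => Submodule.sum_mem _ fun i _ =>
    Submodule.smul_mem _ _ (he.mem hy i)⟩, ?_⟩
  exact he.sum_inner_smul hx hv

theorem torOp_add (u w : TangentSpace 𝓘(ℝ, E) x) :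
    torOp H cov x (u + w) = torOp H cov x u + torOp H cov x w := by
  refine LinearMap.ext fun v => ?_
  simp [torOp]

namespace IsOrientedVerticalFrame

theorem mem (hU : IsOrientedVerticalFrame H O U) (hx : x ∈ O) (a : Fin 3) : U a x ∈ vert H x := by
  rw [← hU.span_eq x hx]
  exact Submodule.subset_span ⟨a, rfl⟩

theorem JV_mul_self (hU : IsOrientedVerticalFrame H O U) (hqc : IsQuaternionicContact h H)
    (hx : x ∈ O) (a : Fin 3) :
    (JV H x (U a x) * JV H x (U a x) : Module.End ℝ (H x)) = -1 := by
  have h1 := hqc.JV_sq (hU.mem hx a)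
  rw [(hU.orthonormal x hx).1 a, one_pow] at h1
  exact h1.trans (neg_one_smul ℝ (LinearMap.id : H x →ₗ[ℝ] H x))

theorem JV_mul_comm (hU : IsOrientedVerticalFrame H O U) (hqc : IsQuaternionicContact h H)
    (hx : x ∈ O) {a b : Fin 3} (hab : a ≠ b) :
    (JV H x (U b x) * JV H x (U a x) : Module.End ℝ (H x)) =
      -(JV H x (U a x) * JV H x (U b x)) := by
  have h1 := hqc.JV_anticomm (hU.mem hx a) (hU.mem hx b)
  rw [(hU.orthonormal x hx).2 hab] at h1
  exact eq_neg_of_add_eq_zero_right (h1.trans (by simp))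

/-- The quaternionic multiplication table of an oriented frame. -/
theorem JV_mul (hU : IsOrientedVerticalFrame H O U) (hqc : IsQuaternionicContact h H)
    {a b : Fin 3} (hab : a ≠ b) :
    ∃ (c : Fin 3) (s : ℝ), s * s = 1 ∧ (∀ d, d = a ∨ d = b ∨ d = c) ∧ ∀ x ∈ O,
      (JV H x (U a x) * JV H x (U b x) : Module.End ℝ (H x)) = s • JV H x (U c x) := by
  have hcyc : ∀ x ∈ O,
      (JV H x (U 0 x) * JV H x (U 1 x) : Module.End ℝ (H x)) = JV H x (U 2 x) ∧
      (JV H x (U 1 x) * JV H x (U 2 x) : Module.End ℝ (H x)) = JV H x (U 0 x) ∧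
      (JV H x (U 2 x) * JV H x (U 0 x) : Module.End ℝ (H x)) = JV H x (U 1 x) := by
    intro x hx
    have hor : (JV H x (U 0 x) * (JV H x (U 1 x) * JV H x (U 2 x)) : Module.End ℝ (H x)) = -1 :=
      hU.oriented x hx
    have h0 := hU.JV_mul_self hqc hx 0
    have h2 := hU.JV_mul_self hqc hx 2
    have h20 := hU.JV_mul_comm hqc hx (a := 0) (b := 2) (by decide)
    exact quaternion_table h0 h2 hor h20
  have hpos : ∀ {c : Fin 3}, (∀ x ∈ O,
      (JV H x (U a x) * JV H x (U b x) : Module.End ℝ (H x)) = JV H x (U c x)) →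
      (∀ d, d = a ∨ d = b ∨ d = c) → ∃ (c : Fin 3) (s : ℝ), s * s = 1 ∧
      (∀ d, d = a ∨ d = b ∨ d = c) ∧ ∀ x ∈ O,
      (JV H x (U a x) * JV H x (U b x) : Module.End ℝ (H x)) = s • JV H x (U c x) :=
    fun {c} h1 h2 => ⟨c, 1, by norm_num, h2, fun x hx => by rw [h1 x hx, one_smul]⟩
  have hneg : ∀ {c : Fin 3}, (∀ x ∈ O,
      (JV H x (U b x) * JV H x (U a x) : Module.End ℝ (H x)) = JV H x (U c x)) →
      (∀ d, d = a ∨ d = b ∨ d = c) → ∃ (c : Fin 3) (s : ℝ), s * s = 1 ∧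
      (∀ d, d = a ∨ d = b ∨ d = c) ∧ ∀ x ∈ O,
      (JV H x (U a x) * JV H x (U b x) : Module.End ℝ (H x)) = s • JV H x (U c x) :=
    fun {c} h1 h2 => ⟨c, -1, by norm_num, h2, fun x hx => by
      rw [hU.JV_mul_comm hqc hx hab.symm, h1 x hx]
      exact (neg_one_smul ℝ (JV H x (U c x))).symm⟩
  fin_cases a <;> fin_cases b
  · exact absurd rfl hab
  · exact hpos (c := 2) (fun x hx => (hcyc x hx).1) (by decide)
  · exact hneg (c := 1) (fun x hx => (hcyc x hx).2.2) (by decide)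
  · exact hneg (c := 2) (fun x hx => (hcyc x hx).1) (by decide)
  · exact absurd rfl hab
  · exact hpos (c := 0) (fun x hx => (hcyc x hx).2.1) (by decide)
  · exact hpos (c := 1) (fun x hx => (hcyc x hx).2.2) (by decide)
  · exact hneg (c := 0) (fun x hx => (hcyc x hx).2.1) (by decide)
  · exact absurd rfl hab

/-- A linear condition on `𝒥(u)` holds for all vertical `u` if it holds on a frame. -/
theorem JV_induction (hU : IsOrientedVerticalFrame H O U) (hqc : IsQuaternionicContact h H)
    (hx : x ∈ O) {G : Type*} [AddCommGroup G] [Module ℝ G] (φ : (H x →ₗ[ℝ] H x) →ₗ[ℝ] G)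
    (hφ : ∀ a, φ (JV H x (U a x)) = 0) {u : TangentSpace 𝓘(ℝ, E) x} (hu : u ∈ vert H x) :
    φ (JV H x u) = 0 := by
  rw [← hU.span_eq x hx] at hu
  induction hu using Submodule.span_induction with
  | mem w hw =>
    obtain ⟨a, rfl⟩ := hw
    exact hφ a
  | zero =>
    have h1 := hqc.JV_smul 0 (hU.mem hx 0)
    rw [zero_smul, zero_smul] at h1
    rw [h1, map_zero]
  | add v w hv hw ihv ihw =>
    rw [hU.span_eq x hx] at hv hw
    rw [hqc.JV_add hv hw, map_add, ihv, ihw, add_zero]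
  | smul c v hv ih =>
    rw [hU.span_eq x hx] at hv
    rw [hqc.JV_smul c hv, map_smul, ih, smul_zero]

end IsOrientedVerticalFrame

end Main

/-! ### Linear functionals and projections used on `𝒥(V*)` -/

section MulOrthogonal

variable {W : Type*} [NormedAddCommGroup W] [InnerProductSpace ℝ W] [FiniteDimensional ℝ W]

/-- The functional `B ↦ ⟨A, B K⟩`. -/
def opInnerMulRight (A K : Module.End ℝ W) : (W →ₗ[ℝ] W) →ₗ[ℝ] ℝ where
  toFun B := opInner A (B ∘ₗ K)
  map_add' B B' := by rw [LinearMap.add_comp, opInner_add_right]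
  map_smul' c B := by rw [LinearMap.smul_comp, opInner_smul_right, RingHom.id_apply, smul_eq_mul]

/-- The functional `B ↦ ⟨A, K B⟩`. -/
def opInnerMulLeft (A K : Module.End ℝ W) : (W →ₗ[ℝ] W) →ₗ[ℝ] ℝ where
  toFun B := opInner A (K ∘ₗ B)
  map_add' B B' := by rw [LinearMap.comp_add, opInner_add_right]
  map_smul' c B := by rw [LinearMap.comp_smul, opInner_smul_right, RingHom.id_apply, smul_eq_mul]

/-- The linear map `B ↦ X B - B X`. -/
def commutatorMap (X : Module.End ℝ W) : (W →ₗ[ℝ] W) →ₗ[ℝ] (W →ₗ[ℝ] W) where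
  toFun B := X ∘ₗ B - B ∘ₗ X
  map_add' B B' := by
    rw [LinearMap.add_comp, LinearMap.comp_add]
    abel
  map_smul' c B := by
    rw [LinearMap.smul_comp, LinearMap.comp_smul, RingHom.id_apply, smul_sub]

/-- `X - K X K` is twice the projection of `X` to the commutant of `K`. Moving `J` past the two
factors `K` costs two signs, so commutation with `J` persists. -/
theorem commutes_sub_conj {J K X : Module.End ℝ W} (hK2 : K * K = -1) (hJK : K * J = -(J * K))
    (hXJ : X * J = J * X) :
    (X - K * X * K) * J = J * (X - K * X * K) ∧ (X - K * X * K) * K = K * (X - K * X * K) := by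
  constructor
  · have h1 : K * X * K * J = J * (K * X * K) := by
      rw [mul_assoc, hJK]
      calc K * X * -(J * K) = -(K * (X * J) * K) := by noncomm_ring
        _ = -((K * J) * X * K) := by rw [hXJ]; noncomm_ring
        _ = J * (K * X * K) := by rw [hJK]; noncomm_ring
    rw [sub_mul, mul_sub, hXJ, h1]
  · have h1 : (X - K * X * K) * K = X * K - K * X * (K * K) := by noncomm_ring
    have h2 : K * (X - K * X * K) = K * X - (K * K) * X * K := by noncomm_ring
    rw [h1, h2, hK2]
    noncomm_ring

theorem adjoint_sub_conj {K X : Module.End ℝ W} (hK : LinearMap.adjoint K = -K)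
    (hX : LinearMap.adjoint X = -X) :
    LinearMap.adjoint (X - K * X * K) = -(X - K * X * K) := by
  rw [map_sub, adjoint_mul, adjoint_mul, hX, hK]
  noncomm_ring

end MulOrthogonal

/-! ### Components of the torsion operators and curvature of a frame plane -/

section Main

variable {E : Type*} [NormedAddCommGroup E] [NormedSpace ℝ E] [FiniteDimensional ℝ E]
  {M : Type*} [TopologicalSpace M] [ChartedSpace E M] [IsManifold 𝓘(ℝ, E) ∞ M]
  [RiemannianBundle (fun x : M => TangentSpace 𝓘(ℝ, E) x)]
  [IsContMDiffRiemannianBundle 𝓘(ℝ, E) ∞ E (fun x : M => TangentSpace 𝓘(ℝ, E) x)]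
  {h : ℕ} {H : (x : M) → Submodule ℝ (TangentSpace 𝓘(ℝ, E) x)}
  {cov : CovariantDerivative 𝓘(ℝ, E) E (TangentSpace 𝓘(ℝ, E) : M → Type _)}
  {N O : Set M} {e : Fin h → (y : M) → TangentSpace 𝓘(ℝ, E) y}
  {U : Fin 3 → (y : M) → TangentSpace 𝓘(ℝ, E) y}
  {A : (y : M) → TangentSpace 𝓘(ℝ, E) y} {x : M}

/-- Products of two elements of `𝒥(V*)` lie in the span of the identity and `𝒥(V*)`; a skew operator
is orthogonal to the identity. -/
theorem IsOrientedVerticalFrame.opInner_JV_comp_JV (hU : IsOrientedVerticalFrame H O U)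
    (hqc : IsQuaternionicContact h H) (hx : x ∈ O) {B : H x →ₗ[ℝ] H x}
    (hB : LinearMap.adjoint B = -B) (horth : ∀ v ∈ vert H x, opInner B (JV H x v) = 0)
    {u w : TangentSpace 𝓘(ℝ, E) x} (hu : u ∈ vert H x) (hw : w ∈ vert H x) :
    opInner B (JV H x w ∘ₗ JV H x u) = 0 := by
  refine hU.JV_induction hqc hx (opInnerMulLeft B (JV H x w)) (fun b => ?_) hu
  refine hU.JV_induction hqc hx (opInnerMulRight B (JV H x (U b x))) (fun a => ?_) hw
  change opInner B (JV H x (U a x) ∘ₗ JV H x (U b x)) = 0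
  rcases eq_or_ne a b with rfl | hab
  · have h1 : JV H x (U a x) ∘ₗ JV H x (U a x) = -1 := hU.JV_mul_self hqc hx a
    rw [h1]
    exact opInner_neg_one_of_skew hB
  · obtain ⟨c, s, -, -, hc⟩ := hU.JV_mul hqc hab
    have h1 : JV H x (U a x) ∘ₗ JV H x (U b x) = s • JV H x (U c x) := hc x hx
    rw [h1, opInner_smul_right, horth _ (hU.mem hx c), mul_zero]

namespace IsBiquardConnection

theorem opInner_skew_torOp_JV (hcov : IsBiquardConnection H cov)
    {u v : TangentSpace 𝓘(ℝ, E) x} (hu : u ∈ vert H x) (hv : v ∈ vert H x) :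
    opInner (skewPart (torOp H cov x u)) (JV H x v) = 0 :=
  (hcov.torsion_op x u hu).2 _ (innerSL_mem_annih hv)

/-- The projection of `A_a` to the commutant of `J_b` still commutes with `J_a`, hence with `J_a
J_b` and with all of `𝒥(V*)`. It is skew, so `A_a` is orthogonal to it by the Biquard condition. -/
theorem skew_torOp_anticomm (hcov : IsBiquardConnection H cov) (hqc : IsQuaternionicContact h H)
    (hU : IsOrientedVerticalFrame H O U) (hx : x ∈ O) {a b : Fin 3} (hab : a ≠ b)
    (hcomm : (skewPart (torOp H cov x (U a x)) * JV H x (U a x) : Module.End ℝ (H x)) =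
      JV H x (U a x) * skewPart (torOp H cov x (U a x))) :
    (skewPart (torOp H cov x (U a x)) * JV H x (U b x) : Module.End ℝ (H x)) =
      -(JV H x (U b x) * skewPart (torOp H cov x (U a x))) := by
  have hX := skewPart_adjoint (torOp H cov x (U a x))
  have hb2 := hU.JV_mul_self hqc hx b
  have hbadj := hqc.JV_adjoint (hU.mem hx b)
  have hba := hU.JV_mul_comm hqc hx hab
  refine anticomm_of_orthogonal hb2 hbadj hX ((hcov.torsion_op x _ (hU.mem hx a)).1 _
    ⟨adjoint_sub_conj hbadj hX, fun ξ hξ => ?_⟩)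
  obtain ⟨u, hu, rfl⟩ := mem_annih_iff.1 hξ
  obtain ⟨ca, cb⟩ := commutes_sub_conj hb2 hba hcomm
  obtain ⟨c, s, hs, hd, hc⟩ := hU.JV_mul hqc hab
  refine sub_eq_zero.1 (hU.JV_induction hqc hx (commutatorMap (skewPart (torOp H cov x (U a x)) -
    JV H x (U b x) * skewPart (torOp H cov x (U a x)) * JV H x (U b x))) (fun d => ?_) hu)
  refine sub_eq_zero.2 ?_
  rcases hd d with rfl | rfl | rfl
  · exact ca
  · exact cb
  · have h1 : JV H x (U d x) = s • (JV H x (U a x) ∘ₗ JV H x (U b x)) := by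
      have h2 : JV H x (U a x) ∘ₗ JV H x (U b x) = s • JV H x (U d x) := hc x hx
      rw [h2, smul_smul, hs, one_smul]
    rw [h1, LinearMap.comp_smul, LinearMap.smul_comp]
    congr 1
    rw [← LinearMap.comp_assoc, LinearMap.comp_assoc (JV H x (U b x))]
    exact (congrArg (· ∘ₗ JV H x (U b x)) ca).trans
      ((LinearMap.comp_assoc _ _ _).trans (congrArg (JV H x (U a x) ∘ₗ ·) cb))

variable [T2Space M]

/-- The right side of `bianchi_HHV` sees only the vertical vector `Tor(X, Y)`, and it is a linear
functional of it. Its dual vector turns the identity into one between operators on `H`. -/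
theorem exists_torOp_eq (hcov : IsBiquardConnection H cov) (hqc : IsQuaternionicContact h H)
    (he : IsHorizontalFrame H N e) (hA : SmoothSection N (vert H) A) {c : ℝ}
    (hc : ∀ y ∈ N, inner ℝ (A y) (A y) = c) (hx : x ∈ N) :
    ∃ w ∈ vert H x, inner ℝ w (A x) = 0 ∧
      LinearMap.adjoint (torOp H cov x (A x)) ∘ₗ JV H x (A x) +
        JV H x (A x) ∘ₗ torOp H cov x (A x) = JV H x w := by
  have : CompleteSpace (TangentSpace 𝓘(ℝ, E) x) := FiniteDimensional.complete ℝ _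
  have hAx := hA.mem x hx
  -- `w₀` represents `v ↦ ⟨Tor(A, v), A⟩`, and `w` below is its vertical part; `⟨w, A⟩ = 0` because
  -- `Tor(A, A) = 0`.
  set w₀ : TangentSpace 𝓘(ℝ, E) x :=
    (InnerProductSpace.toDual ℝ _).symm ((innerSL ℝ (A x)).comp (cov.torsion x (A x))) with hw₀
  have hinner₀ : ∀ v, inner ℝ w₀ v = inner ℝ (cov.torsion x (A x) v) (A x) := by
    intro v
    rw [hw₀, InnerProductSpace.toDual_symm_apply, ContinuousLinearMap.comp_apply,
      innerSL_apply_apply, real_inner_comm]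
  set w : TangentSpace 𝓘(ℝ, E) x := w₀ - horProj H x w₀ with hw
  have hwV : w ∈ vert H x := by
    rw [vert, Submodule.mem_orthogonal]
    intro v hv
    have h1 := inner_horProj_right (H := H) ⟨v, hv⟩ w₀
    rw [Submodule.coe_inner] at h1
    rw [hw, inner_sub_right, sub_eq_zero]
    exact h1.symm
  have hinner : ∀ v ∈ vert H x, inner ℝ v w = inner ℝ (cov.torsion x (A x) v) (A x) := by
    intro v hv
    rw [← hinner₀ v, hw, inner_sub_right, inner_vert_hor hv (Subtype.prop _), sub_zero,
      real_inner_comm]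
  refine ⟨w, hwV, ?_, ?_⟩
  · rw [real_inner_comm, hinner _ hAx, cov.torsion_self, inner_zero_left]
  · refine LinearMap.ext fun v => ext_inner_right ℝ fun z => ?_
    obtain ⟨X, hX, hXv⟩ := he.exists_smoothSection hx v.2
    obtain ⟨Y, hY, hYz⟩ := he.exists_smoothSection hx z.2
    have hb := hcov.bianchi_HHV hqc he hA hc hX hY hx
    have hXx := hX.mem x hx
    have hYx := hY.mem x hx
    rw [← hinner _ (hcov.torsion_HH x _ hXx _ hYx), hcov.inner_torsion_HH hqc hwV hXx hYx,
      ← hcov.coe_torOp hAx hXx, ← hcov.coe_torOp hAx hYx, hXv, hYz, jvec_coe, jvec_coe, jvec_coe,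
      horProj_coe, horProj_coe] at hb
    rw [LinearMap.add_apply, inner_add_left, LinearMap.comp_apply, LinearMap.comp_apply,
      LinearMap.adjoint_inner_left]
    exact hb

/-- Any constant nonzero length is allowed, since the sum of two frame fields is needed as well as
the frame fields themselves. -/
theorem torOp_components (hcov : IsBiquardConnection H cov) (hqc : IsQuaternionicContact h H)
    (he : IsHorizontalFrame H N e) (hU : IsOrientedVerticalFrame H O U)
    (hA : SmoothSection N (vert H) A) {c : ℝ} (hc0 : c ≠ 0)
    (hc : ∀ y ∈ N, inner ℝ (A y) (A y) = c) (hx : x ∈ N) (hxO : x ∈ O) :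
    (symPart (torOp H cov x (A x)) * JV H x (A x) + JV H x (A x) * symPart (torOp H cov x (A x)) :
      Module.End ℝ (H x)) = 0 ∧
    (skewPart (torOp H cov x (A x)) * JV H x (A x) : Module.End ℝ (H x)) =
      JV H x (A x) * skewPart (torOp H cov x (A x)) := by
  have hAx := hA.mem x hx
  obtain ⟨w, hw, hwA, hT⟩ := hcov.exists_torOp_eq hqc he hA hc hx
  have hsq := hqc.JV_sq hAx
  rw [← real_inner_self_eq_norm_sq, hc x hx] at hsq
  have hanti := hqc.JV_anticomm hw hAx
  rw [hwA] at hanti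
  exact sym_anticomm_skew_comm hc0 hsq (hqc.JV_adjoint hAx) (hqc.JV_adjoint hw)
    (eq_neg_of_add_eq_zero_left (hanti.trans (by simp))) hT
    (hU.opInner_JV_comp_JV hqc hxO (skewPart_adjoint _)
      (fun v hv => hcov.opInner_skew_torOp_JV hAx hv) hAx hw)

/-- The relations between the torsion operators along two elements of an oriented frame, and the
curvature of the plane which they span. -/
theorem frame_pair (hcov : IsBiquardConnection H cov) (hqc : IsQuaternionicContact h H)
    (hV : IsInvolutive (vert H)) (hU : IsOrientedVerticalFrame H O U) (hx : x ∈ O)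
    {a b : Fin 3} (hab : a ≠ b) :
    opInner (torSkew H cov U b x) (torSkew H cov U b x) =
        opInner (torSkew H cov U a x) (torSkew H cov U a x) ∧
      opInner (commPart (JV H x (U a x)) (torSym H cov U b x))
          (commPart (JV H x (U a x)) (torSym H cov U b x)) =
        opInner (commPart (JV H x (U b x)) (torSym H cov U a x))
          (commPart (JV H x (U b x)) (torSym H cov U a x)) ∧
      h * inner ℝ (curvature cov (U a) (U b) (U b) x) (U a x) =
        2 * (2 * opInner (torSkew H cov U a x) (torSkew H cov U a x) -
          2 * opInner (commPart (JV H x (U b x)) (torSym H cov U a x))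
            (commPart (JV H x (U b x)) (torSym H cov U a x))) := by
  obtain ⟨N₀, e, hx₀, he₀⟩ := hqc.smooth.exists_frame x
  have hN : IsOpen (N₀ ∩ O) := he₀.isOpen.inter hU.isOpen
  have he := he₀.mono hN Set.inter_subset_left
  have hxN : x ∈ N₀ ∩ O := ⟨hx₀, hx⟩
  have hs : ∀ d, SmoothSection (N₀ ∩ O) (vert H) (U d) := fun d =>
    ⟨fun y hy => (hU.smooth d y hy.2).contMDiffAt (hU.isOpen.mem_nhds hy.2),
      fun y hy => hU.mem hy.2 d⟩
  have hn : ∀ d, ∀ y ∈ N₀ ∩ O, ‖U d y‖ = 1 := fun d y hy => (hU.orthonormal y hy.2).1 d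
  have hin : ∀ d, ∀ y ∈ N₀ ∩ O, inner ℝ (U d y) (U d y) = 1 := fun d y hy => by
    rw [real_inner_self_eq_norm_sq, hn d y hy, one_pow]
  have hsum : SmoothSection (N₀ ∩ O) (vert H) (U a + U b) :=
    ⟨(hs a).smooth.add (hs b).smooth, fun y hy => add_mem ((hs a).mem y hy) ((hs b).mem y hy)⟩
  have hin2 : ∀ y ∈ N₀ ∩ O, inner ℝ ((U a + U b) y) ((U a + U b) y) = 2 := fun y hy => by
    have h1 : inner ℝ (U a y) (U b y) = 0 := (hU.orthonormal y hy.2).2 hab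
    rw [Pi.add_apply, real_inner_add_add_self, hin a y hy, hin b y hy, h1]
    norm_num
  have ca := hcov.torOp_components hqc he hU (hs a) one_ne_zero (hin a) hxN hx
  have cb := hcov.torOp_components hqc he hU (hs b) one_ne_zero (hin b) hxN hx
  have cab := hcov.torOp_components hqc he hU hsum two_ne_zero hin2 hxN hx
  rw [Pi.add_apply, torOp_add, hqc.JV_add (hU.mem hx a) (hU.mem hx b)] at cab
  obtain ⟨h1, h2, h3⟩ := torsion_pair (hU.JV_mul_self hqc hx a) (hU.JV_mul_self hqc hx b)
    (hU.JV_mul_comm hqc hx hab) (hqc.JV_adjoint (hU.mem hx a)) (hqc.JV_adjoint (hU.mem hx b))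
    ca cb cab (hcov.skew_torOp_anticomm hqc hU hx hab ca.2)
    (hcov.skew_torOp_anticomm hqc hU hx hab.symm cb.2)
  refine ⟨h1, h2, ?_⟩
  obtain ⟨d, s, -, -, hd⟩ := hU.JV_mul hqc hab
  -- The sign `s` and index `d` are the same at all points, so this is a smooth vertical field; at
  -- `x` its image under `𝒥` is `J_a J_b`.
  have hC : SmoothSection (N₀ ∩ O) (vert H) (s • U d) :=
    ⟨(hs d).smooth.const_smul s, fun y hy => Submodule.smul_mem _ s ((hs d).mem y hy)⟩
  have hABC : JV H x (U a x) ∘ₗ JV H x (U b x) = JV H x ((s • U d) x) := by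
    rw [Pi.smul_apply, hqc.JV_smul s (hU.mem hx d)]
    exact hd x hx
  rw [hcov.inner_curvature_eq hqc hV he (hs a) (hs b) hC (hn b) hxN
    ((hU.orthonormal x hx).2 hab) hABC, ← hABC]
  exact congrArg (2 * ·) h3

end IsBiquardConnection

end Main

end QC

end

theorem mainTheorem10
    {E : Type*} [NormedAddCommGroup E] [NormedSpace ℝ E] [FiniteDimensional ℝ E]
    {M : Type*} [TopologicalSpace M] [T2Space M] [ChartedSpace E M] [IsManifold 𝓘(ℝ, E) ∞ M]
    [RiemannianBundle (fun x : M => TangentSpace 𝓘(ℝ, E) x)]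
    [IsContMDiffRiemannianBundle 𝓘(ℝ, E) ∞ E (fun x : M => TangentSpace 𝓘(ℝ, E) x)]
    (h : ℕ) (H : (x : M) → Submodule ℝ (TangentSpace 𝓘(ℝ, E) x))
    (hqc : QC.IsQuaternionicContact h H)
    (cov : CovariantDerivative 𝓘(ℝ, E) E (TangentSpace 𝓘(ℝ, E) : M → Type _))
    (hcov : QC.IsBiquardConnection H cov)
    (hV : QC.IsInvolutive (QC.vert H))
    (O : Set M) (U : Fin 3 → (y : M) → TangentSpace 𝓘(ℝ, E) y)
    (hU : QC.IsOrientedVerticalFrame H O U) (x : M) (hx : x ∈ O) :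
    ∃ Tbar : ℝ, (∀ c : Fin 3, Tbar = QC.opNorm (QC.torSkew H cov U c x)) ∧
      ∀ a b : Fin 3, a ≠ b →
        (h : ℝ) / 4 * QC.sectionalCurvature cov (U a) (U b) x =
            Tbar ^ 2 -
              QC.opNorm (QC.commPart (QC.JV H x (U b x)) (QC.torSym H cov U a x)) ^ 2 ∧
        (h : ℝ) / 4 * QC.sectionalCurvature cov (U a) (U b) x =
            Tbar ^ 2 -
              QC.opNorm (QC.commPart (QC.JV H x (U a x)) (QC.torSym H cov U b x)) ^ 2 := by
  have hnorm : ∀ c : Fin 3, QC.opNorm (QC.torSkew H cov U 0 x) =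
      QC.opNorm (QC.torSkew H cov U c x) := by
    intro c
    rcases eq_or_ne c 0 with rfl | hc
    · rfl
    · rw [QC.opNorm, QC.opNorm, (hcov.frame_pair hqc hV hU hx hc).1]
  refine ⟨QC.opNorm (QC.torSkew H cov U 0 x), hnorm, fun a b hab => ?_⟩
  obtain ⟨-, h2, h3⟩ := hcov.frame_pair hqc hV hU hx hab
  have hK : QC.sectionalCurvature cov (U a) (U b) x =
      inner ℝ (QC.curvature cov (U a) (U b) (U b) x) (U a x) := by
    have hab0 : inner ℝ (U a x) (U b x) = 0 := (hU.orthonormal x hx).2 hab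
    rw [QC.sectionalCurvature, (hU.orthonormal x hx).1 a, (hU.orthonormal x hx).1 b, hab0]
    norm_num
  -- The `4` combines the factor two of the curvature trace with the factor two of the commutator
  -- trace.
  have key : (h : ℝ) / 4 * QC.sectionalCurvature cov (U a) (U b) x =
      QC.opNorm (QC.torSkew H cov U 0 x) ^ 2 -
        QC.opNorm (QC.commPart (QC.JV H x (U b x)) (QC.torSym H cov U a x)) ^ 2 := by
    rw [hnorm a, QC.opNorm_sq, QC.opNorm_sq, hK]
    linarith
  refine ⟨key, ?_⟩
  rw [key, QC.opNorm_sq (QC.commPart (QC.JV H x (U a x)) _), h2, QC.opNorm_sq (QC.commPart _ _)]
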